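/- **Setting.** An MDP $\mathcal M=(S,s_0,A,P,L)$ has finite $S$ and $A$, an initial state $s_0$, a labelling $L:S\to 2^{AP}$, and $P:S\times A\times S\to[0,1]$ with $\sum_{s'}P(s,a,s')\in\{0,1\}$; $A(s)$ is the set of actions $a$ with $\sum_{s'}P(s,a,s')=1$ (the enabled actions). A scheduler $\mu$ chooses at every state $s$ with $A(s)\ne\emptyset$ a probability distribution on $A(s)$, depending on $s$ only (a run stays forever at a state with $A(s)=\emptyset$). For a reward function $\rho$ on state-action pairs and a set $B$ of target states, the reward of an infinite path $s_1a_1s_2a_2\dots$ from $s_0$ is $\sum_{i<m}\rho(s_i,a_i)$, where $m$ is least with $s_m\in B$, and is $\infty$ if there is no such $m$; $\mathbf E^{\mathcal M[\rho],\mu}$ is its expectation under $\mu$. Let $n\ge 1$ and $I=J=\{1,\dots,n\}$. Agent $i\in I$ is an MDP $\mathcal M_i=(S_i,s_{i,0},A_i,P_i,L_i)$ with $A_i(s)\neq\emptyset$ for all $s$ and a reward function $\rho_i$; task $j\in J$ is a finite DFA $\mathcal A_j=(Q_j,q_{j,0},Q_{j,F},2^{AP},\delta_j)$ whose accepting locations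 are sinks, and $Q_{j,R}$ is the set of locations from which $Q_{j,F}$ is unreachable. Task $j$ is *ended* at $q$ if $q\in Q_{j,F}\cup Q_{j,R}$. The agent-task MDP $\mathcal M_{i\otimes j}$ has states $S_i\times Q_j$, initial state $(s_{i,0},q_{j,0})$, actions $A_i$, and transition probability $P_i(s,a,s')$ from $(s,q)$ under $a$ to $(s',q')$ if $q'=\delta_j(q,L_i(s'))$, and $0$ otherwise; its target set is the set of $(s,q)$ at which task $j$ is ended. The function $\rho_i$ is read on $\mathcal M_{i\otimes j}$ by $\rho_i(s,q,a)=\rho_i(s,a)$, and $\rho_{j+n}(s,q,a)$ is $1$ if $q\in Q_j\setminus Q_{j,F}$ and every successor of $q$ is in $Q_{j,F}$, and $0$ otherwise. On $\mathcal M_{i\otimes j}$ all $\rho_k$ with $k\notin\{i,j+n\}$ are $0$. Assume $\sup_\mu\mathbf E^{\mathcal M_{i\otimes j}[\rho_i],\mu}<\infty$ for all $i,j$. The centralised MDP $\mathcal M^{\mathsf{ct}}$ has states $(s,q,T)$ with $s\in S_i$, $q\in Q_j$ for some $i,j$ (disjoint unions over $i$ and $j$), and $T\subseteq I$; initial state $(s_{1,0},q_{1,0},\emptyset)$;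 actions $\bigcup_iA_i$ and three further actions $b_1,b_2,b_3$. For $s\in S_i$, $q\in Q_j$: * if $i\in T$ and task $j$ is not ended at $q$, the actions $a\in A_i(s)$ are enabled and act as in $\mathcal M_{i\otimes j}$, leaving $T$ unchanged; * if $s=s_{i,0}$, $q=q_{j,0}$ and $i\notin T$, then $b_1$ leads to $(s,q,T\cup\{i\})$, and $b_2$ leads to $(s_{i',0},q,T)$ with $i'=\min\{i''>i: i''\notin T\}$, if it exists; * if $i\in T$, task $j$ is ended at $q$ and $j<n$, then $b_3$ leads to $(s_{i',0},q_{j+1,0},T)$ with $i'=\min\{i'':i''\notin T\}$, if it exists. No other action is enabled. The target set consists of the states $(s,q,T)$ with $q\in Q_n$ at which task $n$ is ended. Reward functions $\rho_{i,j}$ on the $\mathcal M_{i\otimes j}$ define one on $\mathcal M^{\mathsf{ct}}$ by $\rho(s,q,T,a)=\rho_{i,j}(s,q,a)$ for $s\in S_i$, $q\in Q_j$, $a\in A_i(s)$, and $\rho=0$ on $b_1,b_2,b_3$; write $\rho\sim(\rho_{i,j})$. Let $\mathscr C_0=\{(\mathbf E^{\mathcal M^{\mathsf{ct}}[\rho_k],\mu})_{1\le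 k\le 2n}:\mu \text{ a scheduler of }\mathcal M^{\mathsf{ct}}\}$ and let $\mathscr C=\{x\in\mathbb R^{2n}:x\le u\text{ for some }u\in\mathscr C_0\}$ be the set of feasible threshold vectors. **Algorithm.** Input: $w\in\mathbb R^{2n}$. For every $(i,j)$ let $\mu_{i,j}$ be a scheduler of $\mathcal M_{i\otimes j}$ maximising $\mathbf E^{\mathcal M_{i\otimes j}[w\cdot\boldsymbol\rho],\mu}$, where $w\cdot\boldsymbol\rho=\sum_kw_k\rho_k$, and let $c_{i,j}$ be the maximum. Let $f:J\to I$ be a bijection maximising $\sum_jc_{f(j),j}$. Return $r\in\mathbb R^{2n}$ with $r_{j+n}=\mathbf E^{\mathcal M_{f(j)\otimes j}[\rho_{j+n}],\mu_{f(j),j}}$ and $r_{f(j)}=\mathbf E^{\mathcal M_{f(j)\otimes j}[\rho_{f(j)}],\mu_{f(j),j}}$ for all $j\in J$. **Theorem.** 1. Let $\rho\sim(\rho_{i,j})$. For every scheduler $\mu$ of $\mathcal M^{\mathsf{ct}}$ there are a bistochastic matrix $(x_{i,j})$ and schedulers $\mu_{i,j}$ of $\mathcal M_{i\otimes j}$ with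 $$\mathbf E^{\mathcal M^{\mathsf{ct}}[\rho],\mu}=\sum_{i,j}x_{i,j}\,\mathbf E^{\mathcal M_{i\otimes j}[\rho_{i,j}],\mu_{i,j}},$$ all these expectations being finite. Moreover, schedulers $\mu^*_{i,j}$ maximising $\mathbf E^{\mathcal M_{i\otimes j}[\rho_{i,j}],\mu}$ exist, and for any such $\mu_{i,j}^*$ there is a permutation matrix $(x_{i,j})$ with $$\max_{\mu}\mathbf E^{\mathcal M^{\mathsf{ct}}[\rho],\mu}=\sum_{i,j}x_{i,j}\,\mathbf E^{\mathcal M_{i\otimes j}[\rho_{i,j}],\mu^*_{i,j}},$$ the maximum on the left being attained and all expectations on the right being finite. 2. Let $w\in\mathbb R^{2n}$ be a weight vector ($w_k\ge0$, $\sum_kw_k=1$). The algorithm has an output on input $w$, and every output $r$ satisfies $r\in\mathscr C_0$, and $\{x: w\cdot x=w\cdot r\}$ is a supporting hyperplane of $\mathscr C$ at $r$, i.e. $r\in\mathscr C$ and $w\cdot x\le w\cdot r$ for all $x\in\mathscr C$. -/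

import Mathlib

open MeasureTheory ProbabilityTheory
open scoped NNReal ENNReal

namespace MORAP

/-! ### Markov decision processes -/

/-- A labelled MDP with state space `S`, actions taken from `A` and atomic propositions `AP`.
Each row `P s a` sums to `1` (the action `a` is enabled at `s`) or to `0` (it is not). -/
structure MDP (S A AP : Type*) [Fintype S] where
  init : S
  P : S → A → S → ℝ≥0
  sum_P : ∀ s a, ∑ s', P s a s' = 0 ∨ ∑ s', P s a s' = 1
  label : S → Set AP

namespace MDP

variable {S A AP : Type*} [Fintype S]

/-- The set `A(s)` of actions enabled at `s`. -/
def enabled (M : MDP S A AP) (s : S) : Set A := {a | ∑ s', M.P s a s' = 1}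

/-- Distribution of the successor of `s` under `a`. A disabled action can be selected only at a
state without any enabled action; the run then remains where it is. -/
noncomputable def next (M : MDP S A AP) (s : S) (a : A) : PMF S :=
  open Classical in
  if h : a ∈ M.enabled s then
    PMF.ofFintype (fun s' => (M.P s a s' : ℝ≥0∞)) (by
      have h' : ∑ s', M.P s a s' = 1 := h
      exact_mod_cast h')
  else PMF.pure s

/-- A memoryless (randomised) scheduler: a probability distribution over `A(s)` at every state `s`.
(At a state with `A(s) = ∅` there is no constraint, and the choice has no effect.) -/
structure Scheduler (M : MDP S A AP) where
  choice : S → PMF A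
  support_subset : ∀ s, (M.enabled s).Nonempty → (choice s).support ⊆ M.enabled s

end MDP

/-- One entry `(s, a)` of a path `s₁ a₁ s₂ a₂ …`. -/
structure Step (S A : Type*) where
  state : S
  action : A

instance {S A : Type*} : MeasurableSpace (Step S A) := ⊤

namespace MDP

variable {S A AP : Type*} [Fintype S]

/-- In the Markov chain induced by `μ`: the pair of `s` and an action drawn from `μ s`. -/
noncomputable def act {M : MDP S A AP} (μ : M.Scheduler) (s : S) : PMF (Step S A) :=
  (μ.choice s).map fun a => ⟨s, a⟩

/-- In the Markov chain induced by `μ`: the distribution of the entry following `x`. -/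
noncomputable def step {M : MDP S A AP} (μ : M.Scheduler) (x : Step S A) : PMF (Step S A) :=
  (M.next x.state x.action).bind (act μ)

/-- The transition kernel of the induced Markov chain; only the last entry of the history counts. -/
noncomputable def stepKernel {M : MDP S A AP} (μ : M.Scheduler) (n : ℕ) :
    Kernel (Π _ : Finset.Iic n, Step S A) (Step S A) where
  toFun h := (step μ (h ⟨n, Finset.mem_Iic.2 le_rfl⟩)).toMeasure
  measurable' := Measurable.comp (g := fun x : Step S A => (step μ x).toMeasure)
    measurable_from_top (measurable_pi_apply _)

instance {M : MDP S A AP} (μ : M.Scheduler) (n : ℕ) : IsMarkovKernel (stepKernel μ n) :=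
  ⟨fun h => PMF.toMeasure.isProbabilityMeasure (step μ (h ⟨n, Finset.mem_Iic.2 le_rfl⟩))⟩

/-- The probability measure over infinite paths from the initial state under `μ`. -/
noncomputable def pathMeasure {M : MDP S A AP} (μ : M.Scheduler) : Measure (ℕ → Step S A) :=
  Kernel.trajMeasure (X := fun _ => Step S A) (act μ M.init).toMeasure (stepKernel μ)

/-- Reward accumulated along the path `π` until a state whose label satisfies `B` is reached;
`∞` if no such state is reached. -/
noncomputable def pathReward (M : MDP S A AP) (ρ : S → A → ℝ) (B : Set AP → Prop)
    (π : ℕ → Step S A) : EReal :=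
  open Classical in
  if h : ∃ k, B (M.label (π k).state) then
    ((∑ t ∈ Finset.range (Nat.find h), ρ (π t).state (π t).action : ℝ) : EReal)
  else ⊤

/-- The reachability reward: the expectation of `pathReward`, i.e. the integral of its positive
part minus the integral of its negative part. -/
noncomputable def expReward (M : MDP S A AP) (ρ : S → A → ℝ) (B : Set AP → Prop)
    (μ : M.Scheduler) : EReal :=
  ((∫⁻ π, (M.pathReward ρ B π).toENNReal ∂(pathMeasure μ) : ℝ≥0∞) : EReal) -
    ((∫⁻ π, (-M.pathReward ρ B π).toENNReal ∂(pathMeasure μ) : ℝ≥0∞) : EReal)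

/-- Reward-finiteness of `M[ρ]` with respect to reaching `B`. -/
def RewardFinite (M : MDP S A AP) (ρ : S → A → ℝ) (B : Set AP → Prop) : Prop :=
  (⨆ μ : M.Scheduler, M.expReward ρ B μ) < ⊤

/-- `μ` belongs to the argmax of the reachability reward over all schedulers. -/
def IsOptimal (M : MDP S A AP) (ρ : S → A → ℝ) (B : Set AP → Prop) (μ : M.Scheduler) : Prop :=
  ∀ μ' : M.Scheduler, M.expReward ρ B μ' ≤ M.expReward ρ B μ

/-- The product of an MDP with a deterministic finite automaton reading its labels. -/
noncomputable def product {Q : Type*} [Fintype Q] (M : MDP S A AP) (D : DFA (Set AP) Q) :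
    MDP (S × Q) A AP where
  init := (M.init, D.start)
  P x a y := open Classical in if y.2 = D.step x.2 (M.label y.1) then M.P x.1 a y.1 else 0
  sum_P x a := by
    classical
    have h : ∑ y : S × Q, (if y.2 = D.step x.2 (M.label y.1) then M.P x.1 a y.1 else 0)
        = ∑ s', M.P x.1 a s' := by
      rw [Fintype.sum_prod_type]
      simp
    have := M.sum_P x.1 a
    rw [← h] at this
    exact this
  label x := M.label x.1

end MDP

/-! ### Agents and tasks -/

section Tasks

variable {AP Q : Type*}

/-- A location from which no run reaches an accepting location. -/
def IsTrap (D : DFA (Set AP) Q) (q : Q) : Prop := ∀ v : List (Set AP), D.evalFrom q v ∉ D.accept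

/-- The task is ended (accomplished or failed) at `q`. -/
def Ended (D : DFA (Set AP) Q) (q : Q) : Prop := q ∈ D.accept ∨ IsTrap D q

/-- The one-off unit reward of a task: `1` exactly at the non-accepting locations all of whose
successors are accepting. -/
noncomputable def taskReward (D : DFA (Set AP) Q) (q : Q) : ℝ :=
  open Classical in if q ∉ D.accept ∧ ∀ W, D.step q W ∈ D.accept then 1 else 0

variable {S A : Type*} [Fintype S] [Fintype Q]

/-- The agent-task MDP: the product, with the additional atomic proposition `done`
(encoded as `none`) holding exactly where the task is ended. -/
noncomputable def agentTask (M : MDP S A AP) (D : DFA (Set AP) Q) :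
    MDP (S × Q) A (Option AP) where
  init := (M.product D).init
  P := (M.product D).P
  sum_P := (M.product D).sum_P
  label x := some '' (M.product D).label x ∪ {p | p = none ∧ Ended D x.2}

/-- Expected reward in an agent-task MDP until the task is ended. -/
noncomputable abbrev agentTaskReward (M : MDP S A AP) (D : DFA (Set AP) Q)
    (ρ : S × Q → A → ℝ) (μ : (agentTask M D).Scheduler) : EReal :=
  (agentTask M D).expReward ρ (fun W => none ∈ W) μ

end Tasks

/-! ### The centralised MDP -/

section Centralised

variable {n : ℕ} {AP A : Type*} {S Q : Fin n → Type*}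

/-- States `(s, q, T)` with `s` in some `S i`, `q` in some `Q j`, and `T` a set of agents. -/
abbrev CtState (S Q : Fin n → Type*) := (Σ i, S i) × (Σ j, Q j) × Finset (Fin n)

/-- The three additional actions: assign the current task to the current agent (`b₁`),
forward it to the next agent (`b₂`), and turn to the next task (`b₃`). -/
inductive CtMove
  | b₁ | b₂ | b₃

variable [∀ i, Fintype (S i)] [∀ j, Fintype (Q j)]

/-- The (deterministic) effect of the three additional actions. -/
def ctMove (M : ∀ i, MDP (S i) A AP) (D : ∀ j, DFA (Set AP) (Q j)) :
    CtMove → CtState S Q → CtState S Q → Prop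
  | .b₁, (⟨i, s⟩, ⟨j, q⟩, T), y =>
      s = (M i).init ∧ q = (D j).start ∧ i ∉ T ∧ y = (⟨i, s⟩, ⟨j, q⟩, insert i T)
  | .b₂, (⟨i, s⟩, ⟨j, q⟩, T), y =>
      s = (M i).init ∧ q = (D j).start ∧ i ∉ T ∧
        ∃ i', IsLeast {i'' | i < i'' ∧ i'' ∉ T} i' ∧ y = (⟨i', (M i').init⟩, ⟨j, q⟩, T)
  | .b₃, (⟨i, _⟩, ⟨j, q⟩, T), y =>
      Ended (D j) q ∧ i ∈ T ∧
        ∃ i' j' : Fin n, IsLeast {i'' | i'' ∉ T} i' ∧ (j' : ℕ) = j + 1 ∧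
          y = (⟨i', (M i').init⟩, ⟨j', (D j').start⟩, T)

theorem ctMove_unique (M : ∀ i, MDP (S i) A AP) (D : ∀ j, DFA (Set AP) (Q j)) {b : CtMove}
    {x y z : CtState S Q} (hy : ctMove M D b x y) (hz : ctMove M D b x z) : y = z := by
  obtain ⟨⟨i, s⟩, ⟨j, q⟩, T⟩ := x
  cases b with
  | b₁ => exact hy.2.2.2.trans hz.2.2.2.symm
  | b₂ =>
    obtain ⟨-, -, -, i₁, h₁, rfl⟩ := hy
    obtain ⟨-, -, -, i₂, h₂, rfl⟩ := hz
    obtain rfl := h₁.unique h₂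
    rfl
  | b₃ =>
    obtain ⟨-, -, i₁, j₁, h₁, e₁, rfl⟩ := hy
    obtain ⟨-, -, i₂, j₂, h₂, e₂, rfl⟩ := hz
    obtain rfl := h₁.unique h₂
    obtain rfl : j₁ = j₂ := Fin.ext (e₁.trans e₂.symm)
    rfl

/-- Transition probabilities of the centralised MDP. An agent that has taken the current task acts
as in the agent-task MDP as long as the task is not ended. -/
noncomputable def ctP (M : ∀ i, MDP (S i) A AP) (D : ∀ j, DFA (Set AP) (Q j)) :
    CtState S Q → A ⊕ CtMove → CtState S Q → ℝ≥0
  | (⟨i, s⟩, ⟨j, q⟩, T), .inl a, y => open Classical in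
      if i ∈ T ∧ ¬ Ended (D j) q then
        ∑ p : S i × Q j,
          if y = (⟨i, p.1⟩, ⟨j, p.2⟩, T) then (agentTask (M i) (D j)).P (s, q) a p else 0
      else 0
  | x, .inr b, y => open Classical in if ctMove M D b x y then 1 else 0

theorem sum_ctP (M : ∀ i, MDP (S i) A AP) (D : ∀ j, DFA (Set AP) (Q j)) (x : CtState S Q)
    (a : A ⊕ CtMove) : ∑ y, ctP M D x a y = 0 ∨ ∑ y, ctP M D x a y = 1 := by
  classical
  obtain ⟨⟨i, s⟩, ⟨j, q⟩, T⟩ := x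
  cases a with
  | inl a =>
    by_cases h : i ∈ T ∧ ¬ Ended (D j) q
    · have e : ∑ y, ctP M D (⟨i, s⟩, ⟨j, q⟩, T) (.inl a) y
          = ∑ p, (agentTask (M i) (D j)).P (s, q) a p := by
        simp only [ctP, if_pos h]
        rw [Finset.sum_comm]
        simp
      rw [e]
      exact (agentTask (M i) (D j)).sum_P _ _
    · left
      simp only [ctP, if_neg h, Finset.sum_const_zero]
  | inr b =>
    by_cases h : ∃ z, ctMove M D b (⟨i, s⟩, ⟨j, q⟩, T) z
    · obtain ⟨z, hz⟩ := h
      right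
      have e : ∀ y, ctMove M D b (⟨i, s⟩, ⟨j, q⟩, T) y ↔ y = z :=
        fun y => ⟨fun hy => ctMove_unique M D hy hz, fun hy => hy ▸ hz⟩
      simp [ctP, e]
    · left
      push Not at h
      simp [ctP, h]

/-- The centralised MDP. Its only atomic proposition, `done`, says that the last task is ended. -/
noncomputable def centralised [NeZero n] (M : ∀ i, MDP (S i) A AP)
    (D : ∀ j, DFA (Set AP) (Q j)) : MDP (CtState S Q) (A ⊕ CtMove) Unit where
  init := (⟨0, (M 0).init⟩, ⟨0, (D 0).start⟩, ∅)
  P := ctP M D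
  sum_P := sum_ctP M D
  label x := {_p | (x.2.1.1 : ℕ) + 1 = n ∧ Ended (D x.2.1.1) x.2.1.2}

/-- Expected reward in the centralised MDP until all tasks are ended. -/
noncomputable abbrev centralReward [NeZero n] (M : ∀ i, MDP (S i) A AP)
    (D : ∀ j, DFA (Set AP) (Q j)) (ρ : CtState S Q → A ⊕ CtMove → ℝ)
    (μ : (centralised M D).Scheduler) : EReal :=
  (centralised M D).expReward ρ (fun W => () ∈ W) μ

/-- The reward structure `ρ` of the centralised MDP restricts to `ρ' i j` on each agent-task MDP,
and the three additional actions carry no reward. -/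
def RestrictsTo (M : ∀ i, MDP (S i) A AP) (ρ : CtState S Q → A ⊕ CtMove → ℝ)
    (ρ' : ∀ i j, S i × Q j → A → ℝ) : Prop :=
  (∀ i j s q T a, a ∈ (M i).enabled s → ρ (⟨i, s⟩, ⟨j, q⟩, T) (.inl a) = ρ' i j (s, q) a) ∧
    ∀ x b, ρ x (.inr b) = 0

/-- View agent-task reward structures as a reward structure of the centralised MDP. -/
noncomputable def ctReward (M : ∀ i, MDP (S i) A AP) (ρ' : ∀ i j, S i × Q j → A → ℝ) :
    CtState S Q → A ⊕ CtMove → ℝ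
  | (⟨i, s⟩, ⟨j, q⟩, _), .inl a => open Classical in
      if a ∈ (M i).enabled s then ρ' i j (s, q) a else 0
  | _, .inr _ => 0

/-- The objectives `ρ_k` on the agent-task MDP of agent `i` and task `j`: `inl i'` is the reward
structure of agent `i'` and `inr j'` the unit reward of task `j'`. -/
noncomputable def objective (D : ∀ j, DFA (Set AP) (Q j)) (ρ : ∀ i, S i → A → ℝ) :
    Fin n ⊕ Fin n → ∀ i j, S i × Q j → A → ℝ
  | .inl i', i, _, x, a => if i = i' then ρ i x.1 a else 0
  | .inr j', _, j, x, _ => if j = j' then taskReward (D j) x.2 else 0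

/-- The weighted combination `w · ρ` of the objectives. -/
noncomputable def weighted (D : ∀ j, DFA (Set AP) (Q j)) (ρ : ∀ i, S i → A → ℝ)
    (w : Fin n ⊕ Fin n → ℝ) (i j : Fin n) (x : S i × Q j) (a : A) : ℝ :=
  ∑ k, w k * objective D ρ k i j x a

/-- `𝒞₀`: the vectors of expected rewards achieved by the schedulers of the centralised MDP. -/
def achievable [NeZero n] (M : ∀ i, MDP (S i) A AP) (D : ∀ j, DFA (Set AP) (Q j))
    (ρ : ∀ i, S i → A → ℝ) : Set (Fin n ⊕ Fin n → ℝ) :=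
  {u | ∃ μ : (centralised M D).Scheduler,
    ∀ k, centralReward M D (ctReward M (objective D ρ k)) μ = (u k : EReal)}

/-- `𝒞`: the downward closure of `𝒞₀`, i.e. the set of feasible threshold vectors. -/
def feasible [NeZero n] (M : ∀ i, MDP (S i) A AP) (D : ∀ j, DFA (Set AP) (Q j))
    (ρ : ∀ i, S i → A → ℝ) : Set (Fin n ⊕ Fin n → ℝ) :=
  {x | ∃ u ∈ achievable M D ρ, x ≤ u}

/-- The hyperplane `{x | w · x = w · u}` supports `C` at its point `u`, from above. -/
def SupportsAt {ι : Type*} [Fintype ι] (C : Set (ι → ℝ)) (w u : ι → ℝ) : Prop :=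
  u ∈ C ∧ ∀ x ∈ C, dotProduct w x ≤ dotProduct w u

/-- `r` is a possible result of the decentralised algorithm on input `w`: compute an optimal
scheduler `μ i j` and its value `c i j` for the weighted reward on every agent-task MDP, then an
optimal assignment `f` of tasks to agents for the values `c`, and evaluate the objectives under the
schedulers `μ (f j) j`. -/
def IsOutput (M : ∀ i, MDP (S i) A AP) (D : ∀ j, DFA (Set AP) (Q j))
    (ρ : ∀ i, S i → A → ℝ) (w r : Fin n ⊕ Fin n → ℝ) : Prop :=
  ∃ (μ : ∀ i j, (agentTask (M i) (D j)).Scheduler) (c : Fin n → Fin n → ℝ)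
    (f : Equiv.Perm (Fin n)),
    (∀ i j, (agentTask (M i) (D j)).IsOptimal (weighted D ρ w i j) (fun W => none ∈ W) (μ i j)) ∧
    (∀ i j, agentTaskReward (M i) (D j) (weighted D ρ w i j) (μ i j) = (c i j : EReal)) ∧
    (∀ g : Equiv.Perm (Fin n), ∑ j, c (g j) j ≤ ∑ j, c (f j) j) ∧
    (∀ j, agentTaskReward (M (f j)) (D j) (objective D ρ (.inr j) (f j) j) (μ (f j) j)
      = (r (.inr j) : EReal)) ∧
    (∀ j, agentTaskReward (M (f j)) (D j) (objective D ρ (.inl (f j)) (f j) j) (μ (f j) j)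
      = (r (.inl (f j)) : EReal))

end Centralised

end MORAP

open MORAP

/-!
Under a memoryless scheduler an MDP is a finite Markov chain. Killing this chain outside a set `G`
gives a substochastic matrix `T` (`MDP.killedMatrix`), and the law of the path shows that the
reachability reward is the series `∑ t, Tᵗ r` at the initial state, where `r` is the one-step
reward (`MDP.expReward_eq_tsum`). If `1 - T` is injective, the series converges to `(1 - T)⁻¹ r`,
the unique solution of the value equations (`IsTransient.hasSum`, `MDP.IsValue`). An MDP is called
*proper* if this holds for all schedulers on a set `R` of states which contains the initial state
and cannot be left before the target is reached (`MDP.IsProper`).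

* Reward-finiteness implies properness (`MDP.exists_isProper`). In the largest set of states in
  which the target can be avoided forever, let a policy stay there, and let it choose all actions
  with positive probability elsewhere. If that set were reachable from the initial state, this
  policy would have the expected reward `∞`: it misses the target with positive probability, while
  the negative part of its reward is integrable. Hence the set is unreachable, and outside of it
  no scheduler can have a closed class of states, which is what injectivity of `1 - T` means by
  the maximum principle.

* For a proper MDP the expected reward is a continuous function of the scheduler, and the
  schedulers form a compact convex set. So optimal schedulers exist, and by the intermediate value
  theorem the values of all schedulers fill a compact interval (`MDP.IsProper.exists_isOptimal`,
  `MDP.IsProper.exists_expReward_eq`).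

* In the centralised MDP, the value at a state in which agent `i` works on task `j` is the value
  of the restricted scheduler on the agent-task MDP plus the value of the remaining tasks
  (`value_working`), and the value at a state of choice is a convex combination of the values
  after taking and after forwarding the task (`value_choice`). Backward induction over the tasks
  then yields a doubly stochastic matrix `x` such that the central value lies between `∑ x m` and
  `∑ x m'`, if `[m i j, m' i j]` contains all values of agent `i` on task `j`
  (`value_isBracketed`). With all rewards zero, this says that the value equations have only the
  zero solution, so the centralised MDP is proper as well (`isProper_centralised`).

* As the agent-task values fill the intervals, the central value is `∑ x e` with attained values
  `e`. By Birkhoff's theorem its maximum is at most the value of the best assignment, and the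
  scheduler that follows a given assignment attains exactly the sum of the agent-task values
  (`ctValue_assignmentPolicy`), for all reward structures at once. The correctness of the
  algorithm follows by linearity of the value in the reward.
-/

namespace MORAP
open Matrix

/-! ### The law of the path -/

instance {S A : Type*} [Fintype S] [Fintype A] : Fintype (Step S A) :=
  Fintype.ofEquiv (S × A) ⟨fun x => ⟨x.1, x.2⟩, fun x => (x.state, x.action), fun _ => rfl,
    fun _ => rfl⟩

theorem sum_step {S A : Type*} [Fintype S] [Fintype A] (g : Step S A → ℝ) :
    ∑ x, g x = ∑ s, ∑ a, g ⟨s, a⟩ := by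
  rw [← Fintype.sum_prod_type']
  exact Fintype.sum_equiv ⟨fun x => (x.state, x.action), fun x => ⟨x.1, x.2⟩, fun _ => rfl,
    fun _ => rfl⟩ _ _ fun _ => rfl

namespace MDP

variable {S A AP : Type*}

/-- The paths that are in `G` at all times `0, …, t`. -/
def aliveSet (A : Type*) (G : Set S) (t : ℕ) : Set (ℕ → Step S A) :=
  {π | ∀ u ≤ t, (π u).state ∈ G}

theorem measurable_eval_step (t : ℕ) {β : Type*} [MeasurableSpace β] (g : Step S A → β) :
    Measurable fun π : ℕ → Step S A => g (π t) :=
  Measurable.comp (g := g) measurable_from_top (measurable_pi_apply t)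

theorem measurableSet_aliveSet (G : Set S) (t : ℕ) : MeasurableSet (aliveSet A G t) := by
  have : aliveSet A G t =
      ⋂ u, ⋂ (_ : u ≤ t), (fun π : ℕ → Step S A => π u) ⁻¹' {x | x.state ∈ G} := by
    ext π; simp [aliveSet]
  rw [this]
  refine MeasurableSet.iInter fun u => MeasurableSet.iInter fun _ => ?_
  exact measurable_pi_apply u MeasurableSet.of_discrete

theorem aliveSet_antitone (G : Set S) : Antitone (aliveSet A G) :=
  fun _ _ h _ hπ u hu => hπ u (hu.trans h)

variable [Fintype S]

instance {M : MDP S A AP} (μ : M.Scheduler) : IsProbabilityMeasure (pathMeasure μ) := by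
  unfold pathMeasure; infer_instance

theorem map_pathMeasure_zero {M : MDP S A AP} (μ : M.Scheduler) :
    (pathMeasure μ).map (fun π => π 0) = (act μ M.init).toMeasure := by
  have h0 : (fun π : ℕ → Step S A => π 0) =
      (MeasurableEquiv.piUnique fun _ : Finset.Iic 0 => Step S A) ∘
        Preorder.frestrictLe (π := fun _ : ℕ => Step S A) 0 := by
    ext π : 1
    rfl
  rw [h0, ← Measure.map_map (by fun_prop) (by fun_prop), pathMeasure, Kernel.trajMeasure,
    Measure.map_comp _ _ (by fun_prop), Kernel.traj_map_frestrictLe, Kernel.partialTraj_self,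
    Measure.id_comp]
  exact MeasurableEquiv.map_map_symm _

variable [Fintype A]

/-- Transition matrix of the Markov chain induced by the action weights `p`, killed outside of
`G`: the rows of states outside of `G` are zero. -/
noncomputable def killedMatrix (M : MDP S A AP) (G : Set S) (p : S → A → ℝ) : Matrix S S ℝ :=
  open Classical in fun s s' => if s ∈ G then ∑ a, p s a * (M.next s a s').toReal else 0

/-- Expected reward of one step under the action weights `p`, counted in `G` only. -/
noncomputable def killedReward (G : Set S) (p ρ : S → A → ℝ) (s : S) : ℝ :=
  open Classical in if s ∈ G then ∑ a, p s a * ρ s a else 0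

/-- The probabilities chosen by a scheduler, as real numbers. -/
noncomputable def Scheduler.weight {M : MDP S A AP} (μ : M.Scheduler) (s : S) (a : A) : ℝ :=
  (μ.choice s a).toReal

theorem toReal_act {M : MDP S A AP} (μ : M.Scheduler) (s t : S) (a : A) [Decidable (t = s)] :
    (act μ s ⟨t, a⟩).toReal = if t = s then μ.weight s a else 0 := by
  classical
  simp only [act, PMF.map_apply, Step.mk.injEq, Scheduler.weight]
  split_ifs with h
  · simp [h, tsum_fintype]
  · simp [h]

theorem integral_act {M : MDP S A AP} (μ : M.Scheduler) (s : S) (g : Step S A → ℝ) :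
    ∫ x, g x ∂(act μ s).toMeasure = ∑ a, μ.weight s a * g ⟨s, a⟩ := by
  classical
  rw [PMF.integral_eq_sum, sum_step, Finset.sum_comm]
  simp [toReal_act]

theorem integral_step {M : MDP S A AP} (μ : M.Scheduler) (x : Step S A) (g : Step S A → ℝ) :
    ∫ y, g y ∂(step μ x).toMeasure =
      ∑ s, (M.next x.state x.action s).toReal * ∑ a, μ.weight s a * g ⟨s, a⟩ := by
  classical
  rw [PMF.integral_eq_sum, sum_step]
  refine Finset.sum_congr rfl fun s _ => ?_
  rw [Finset.mul_sum]
  refine Finset.sum_congr rfl fun a _ => ?_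
  rw [step, PMF.bind_apply, tsum_fintype, ENNReal.toReal_sum, smul_eq_mul]
  · simp [ENNReal.toReal_mul, toReal_act, mul_assoc]
  · intro s' _
    exact ENNReal.mul_ne_top (PMF.apply_ne_top _ _) (PMF.apply_ne_top _ _)

theorem norm_le_const (g : Step S A → ℝ) : ∃ C, 0 ≤ C ∧ ∀ x, |g x| ≤ C :=
  ⟨∑ x, |g x|, by positivity, fun x =>
    Finset.single_le_sum (f := fun x => |g x|) (fun _ _ => abs_nonneg _) (Finset.mem_univ x)⟩

theorem integrable_indicator_alive {M : MDP S A AP} (μ : M.Scheduler) (G : Set S) (t u : ℕ)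
    (g : Step S A → ℝ) :
    Integrable ((aliveSet A G t).indicator fun π => g (π u)) (pathMeasure μ) := by
  obtain ⟨C, -, hC⟩ := norm_le_const g
  refine Integrable.indicator ?_ (measurableSet_aliveSet G t)
  exact Integrable.of_bound (measurable_eval_step u g).aestronglyMeasurable C
    (Filter.Eventually.of_forall fun π => hC _)

/-- Markov property at time `t`. -/
theorem integral_alive_succ {M : MDP S A AP} (μ : M.Scheduler) (G : Set S) (t : ℕ)
    (g : Step S A → ℝ) :
    ∫ π, (aliveSet A G t).indicator (fun π => g (π (t + 1))) π ∂pathMeasure μ =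
      ∫ π, (aliveSet A G t).indicator
        (fun π => ∫ y, g y ∂(step μ (π t)).toMeasure) π ∂pathMeasure μ := by
  classical
  -- The event `aliveSet A G t`, read on the history up to time `t`.
  set H : Set (Π _ : Finset.Iic t, Step S A) := {h | ∀ u, (h u).state ∈ G} with hH
  have key := Kernel.map_frestrictLe_trajMeasure_compProd_eq_map_trajMeasure
    (X := fun _ => Step S A) (μ₀ := (act μ M.init).toMeasure) (κ := stepKernel μ) (a := t)
  change (pathMeasure μ).map _ ⊗ₘ _ = (pathMeasure μ).map _ at key
  have hmem : ∀ π : ℕ → Step S A,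
      π ∈ aliveSet A G t ↔ Preorder.frestrictLe (π := fun _ => Step S A) t π ∈ H := by
    intro π
    simp [aliveSet, hH, Preorder.frestrictLe]
  have hHm : MeasurableSet H := MeasurableSet.of_discrete
  let F : (Π _ : Finset.Iic t, Step S A) × Step S A → ℝ := fun z => if z.1 ∈ H then g z.2 else 0
  have hF : Measurable F := Measurable.of_discrete
  have hfr : Measurable (Preorder.frestrictLe (π := fun _ : ℕ => Step S A) t) := by fun_prop
  have h1 : ∫ π, (aliveSet A G t).indicator (fun π => g (π (t + 1))) π ∂pathMeasure μ
      = ∫ z, F z ∂((pathMeasure μ).map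
        (fun x => (Preorder.frestrictLe (π := fun _ => Step S A) t x, x (t + 1)))) := by
    rw [integral_map (by fun_prop) hF.aestronglyMeasurable]
    refine integral_congr_ae (Filter.Eventually.of_forall fun π => ?_)
    simp only [Set.indicator, hmem, F]
  have : IsProbabilityMeasure
      ((pathMeasure μ).map (Preorder.frestrictLe (π := fun _ : ℕ => Step S A) t)) :=
    Measure.isProbabilityMeasure_map hfr.aemeasurable
  rw [h1, ← key, Measure.integral_compProd, integral_map hfr.aemeasurable]
  · refine integral_congr_ae (Filter.Eventually.of_forall fun π => ?_)
    simp only [Set.indicator, hmem, F]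
    split_ifs
    · rfl
    · simp
  · exact (Measurable.of_discrete).aestronglyMeasurable
  · obtain ⟨C, h0, hC⟩ := norm_le_const g
    refine Integrable.of_bound hF.aestronglyMeasurable C (Filter.Eventually.of_forall fun z => ?_)
    simp only [F]
    split_ifs
    · exact hC _
    · simpa using h0

/-- The expected reward at time `t` on the paths that have not left `G` is given by the `t`-th
power of the killed transition matrix. -/
theorem integral_alive {M : MDP S A AP} (μ : M.Scheduler) (G : Set S) (t : ℕ)
    [DecidableEq S] (ρ : S → A → ℝ) :
    ∫ π, (aliveSet A G t).indicator (fun π => ρ (π t).state (π t).action) π ∂pathMeasure μ =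
      ((M.killedMatrix G μ.weight) ^ t *ᵥ killedReward G μ.weight ρ) M.init := by
  classical
  induction t generalizing ρ with
  | zero =>
    have h : ∀ π : ℕ → Step S A, (aliveSet A G 0).indicator
        (fun π => ρ (π 0).state (π 0).action) π =
        (fun x : Step S A => if x.state ∈ G then ρ x.state x.action else 0) (π 0) := by
      intro π
      simp only [Set.indicator, aliveSet, Nat.le_zero, Set.mem_ofPred_eq, forall_eq]
    simp_rw [h]
    have := integral_map (μ := pathMeasure μ) (φ := fun π => π 0)
      (f := fun x : Step S A => if x.state ∈ G then ρ x.state x.action else 0)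
      (measurable_pi_apply 0).aemeasurable Measurable.of_discrete.aestronglyMeasurable
    rw [← this, map_pathMeasure_zero, integral_act]
    simp only [killedReward, pow_zero, one_mulVec]
    split_ifs <;> simp
  | succ t ih =>
    have h : ∀ π : ℕ → Step S A, (aliveSet A G (t + 1)).indicator
        (fun π => ρ (π (t + 1)).state (π (t + 1)).action) π = (aliveSet A G t).indicator
        (fun π => (fun x : Step S A => if x.state ∈ G then ρ x.state x.action else 0)
          (π (t + 1))) π := by
      intro π
      have : π ∈ aliveSet A G (t + 1) ↔ π ∈ aliveSet A G t ∧ (π (t + 1)).state ∈ G := by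
        simp only [aliveSet, Set.mem_ofPred_eq, Nat.le_succ_iff, or_imp, forall_and, forall_eq]
      simp only [Set.indicator, this]
      split_ifs <;> simp_all
    simp_rw [h]
    rw [integral_alive_succ μ G t
      (fun x : Step S A => if x.state ∈ G then ρ x.state x.action else 0)]
    have := ih (fun s a => ∑ s', (M.next s a s').toReal * killedReward G μ.weight ρ s')
    have e : ∀ x : Step S A, ∫ y, (if y.state ∈ G then ρ y.state y.action else 0)
        ∂(step μ x).toMeasure =
        ∑ s', (M.next x.state x.action s').toReal * killedReward G μ.weight ρ s' := by
      intro x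
      rw [integral_step]
      refine Finset.sum_congr rfl fun s' _ => ?_
      simp only [killedReward]
      split_ifs <;> simp
    simp_rw [e]
    rw [this, pow_succ, ← mulVec_mulVec]
    congr 2
    ext s
    simp only [killedReward, killedMatrix, mulVec, dotProduct]
    split_ifs
    · simp_rw [Finset.mul_sum, Finset.sum_mul]
      rw [Finset.sum_comm]
      simp [mul_assoc]
    · simp

end MDP
end MORAP

namespace MORAP
open Matrix Filter Topology

/-! ### Reachability rewards as series -/

theorem integrable_tsum_of_summable_integral_norm {α : Type*} [MeasurableSpace α] {μ : Measure α}
    {F : ℕ → α → ℝ} (hF : ∀ t, Integrable (F t) μ) (hs : Summable fun t => ∫ a, ‖F t a‖ ∂μ) :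
    Integrable (fun a => ∑' t, F t a) μ := by
  have hfin : ∫⁻ a, ∑' t, ‖F t a‖ₑ ∂μ ≠ ∞ := by
    rw [lintegral_tsum fun t => (hF t).1.enorm]
    simp_rw [← ofReal_integral_norm_eq_lintegral_enorm (hF _)]
    rw [← ENNReal.ofReal_tsum_of_nonneg (fun t => integral_nonneg fun _ => norm_nonneg _) hs]
    exact ENNReal.ofReal_ne_top
  have hae : ∀ᵐ a ∂μ, Summable fun t => F t a := by
    filter_upwards [ae_lt_top' (AEMeasurable.tsum fun t => (hF t).1.enorm) hfin] with a ha
    exact Summable.of_norm (by simpa [enorm] using ENNReal.tsum_coe_ne_top_iff_summable_coe.1 ha.ne)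
  refine ⟨aestronglyMeasurable_of_tendsto_ae atTop
    (f := fun N a => ∑ t ∈ Finset.range N, F t a) (fun N => ?_) ?_, ?_⟩
  · exact Finset.aestronglyMeasurable_fun_sum _ fun t _ => (hF t).1
  · filter_upwards [hae] with a ha
    exact ha.hasSum.tendsto_sum_nat
  · refine lt_of_le_of_lt (lintegral_mono fun a => ?_) hfin.lt_top
    exact enorm_tsum_le_tsum_enorm

namespace MDP
variable {S A AP : Type*} [Fintype S]

/-- The states outside of the target set. -/
def liveSet (M : MDP S A AP) (B : Set AP → Prop) : Set S := {s | ¬ B (M.label s)}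

open Classical in
/-- On a path that reaches the target, the reward is the sum of the rewards of all entries that
precede the first visit of the target. -/
theorem pathReward_eq_tsum (M : MDP S A AP) (ρ : S → A → ℝ) (B : Set AP → Prop)
    {π : ℕ → Step S A} {t : ℕ} (h : π ∉ aliveSet A (M.liveSet B) t) :
    M.pathReward ρ B π = ((∑' t, (aliveSet A (M.liveSet B) t).indicator
      (fun π => ρ (π t).state (π t).action) π : ℝ) : EReal) := by
  have hex : ∃ k, B (M.label (π k).state) := by
    simp only [aliveSet, liveSet, Set.mem_ofPred_eq, not_forall, not_not] at h
    obtain ⟨k, -, hk⟩ := h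
    exact ⟨k, hk⟩
  have hmem : ∀ t, π ∈ aliveSet A (M.liveSet B) t ↔ t < Nat.find hex := by
    intro t
    simp only [aliveSet, liveSet, Set.mem_ofPred_eq, Nat.lt_find_iff]
  rw [pathReward, dif_pos hex]
  congr 1
  rw [tsum_eq_sum (s := Finset.range (Nat.find hex))]
  · refine Finset.sum_congr rfl fun t ht => ?_
    rw [Set.indicator_of_mem ((hmem t).2 (Finset.mem_range.1 ht))]
  · intro t ht
    rw [Set.indicator_of_notMem]
    rw [hmem]
    simpa using ht

theorem pathReward_eq_top (M : MDP S A AP) (ρ : S → A → ℝ) (B : Set AP → Prop)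
    {π : ℕ → Step S A} (h : ∀ t, π ∈ aliveSet A (M.liveSet B) t) :
    M.pathReward ρ B π = ⊤ := by
  rw [pathReward, dif_neg]
  rintro ⟨k, hk⟩
  have := h k k le_rfl
  simp only [liveSet, Set.mem_ofPred_eq] at this
  exact this hk

variable [Fintype A] [DecidableEq S]

/-- Expected reward at time `t`, earned only if `G` has not been left up to this time. -/
noncomputable def killedValue (M : MDP S A AP) (G : Set S) (p ρ : S → A → ℝ) (t : ℕ) : ℝ :=
  (M.killedMatrix G p ^ t *ᵥ killedReward G p ρ) M.init

theorem measureReal_aliveSet {M : MDP S A AP} (μ : M.Scheduler) (G : Set S) (t : ℕ) :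
    (pathMeasure μ).real (aliveSet A G t) = M.killedValue G μ.weight (fun _ _ => 1) t := by
  rw [killedValue, ← integral_alive μ G t (fun _ _ => 1)]
  exact (integral_indicator_one (measurableSet_aliveSet G t)).symm

/-- If the expected time spent before reaching the target is finite, the target is reached
almost surely, and the expected reward is the sum of the expected rewards at all times. -/
theorem expReward_eq_tsum {M : MDP S A AP} (μ : M.Scheduler) (B : Set AP → Prop)
    (ρ : S → A → ℝ) (hs : Summable (M.killedValue (M.liveSet B) μ.weight fun _ _ => 1)) :
    M.expReward ρ B μ = ((∑' t, M.killedValue (M.liveSet B) μ.weight ρ t : ℝ) : EReal) := by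
  set G := M.liveSet B with hG
  obtain ⟨C, hC0, hC⟩ := norm_le_const (fun x : Step S A => ρ x.state x.action)
  set F : ℕ → (ℕ → Step S A) → ℝ := fun t =>
    (aliveSet A G t).indicator (fun π => ρ (π t).state (π t).action) with hFdef
  have hF : ∀ t, Integrable (F t) (pathMeasure μ) := fun t =>
    integrable_indicator_alive μ G t t (fun x => ρ x.state x.action)
  have hFs : Summable fun t => ∫ π, ‖F t π‖ ∂pathMeasure μ := by
    refine Summable.of_nonneg_of_le (fun t => integral_nonneg fun _ => norm_nonneg _) (fun t => ?_)
      (hs.mul_left C)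
    rw [← measureReal_aliveSet, ← integral_indicator_one (measurableSet_aliveSet G t),
      ← integral_const_mul]
    refine integral_mono (hF t).norm (((integrable_const 1).indicator
      (measurableSet_aliveSet G t)).const_mul C) fun π => ?_
    by_cases h : π ∈ aliveSet A G t
    · simpa [F, h] using hC (π t)
    · simp [F, h]
  have hX := integrable_tsum_of_summable_integral_norm hF hFs
  have hsum := (hasSum_integral_of_summable_integral_norm hF hFs).tsum_eq
  have hae : ∀ᵐ π ∂pathMeasure μ, M.pathReward ρ B π = ((∑' t, F t π : ℝ) : EReal) := by
    have h0 : pathMeasure μ (⋂ t, aliveSet A G t) = 0 := by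
      rw [← measureReal_eq_zero_iff]
      refine le_antisymm ?_ measureReal_nonneg
      refine ge_of_tendsto' hs.tendsto_atTop_zero fun t => ?_
      rw [← measureReal_aliveSet]
      exact measureReal_mono (Set.iInter_subset _ t)
    filter_upwards [measure_eq_zero_iff_ae_notMem.1 h0] with π hπ
    simp only [Set.mem_iInter, not_forall] at hπ
    obtain ⟨t, ht⟩ := hπ
    exact pathReward_eq_tsum M ρ B ht
  have e : ∑' t, M.killedValue G μ.weight ρ t = ∫ π, ∑' t, F t π ∂pathMeasure μ := by
    rw [← hsum]
    exact tsum_congr fun t => (integral_alive μ G t ρ).symm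
  rw [e, integral_eq_lintegral_pos_part_sub_lintegral_neg_part hX, EReal.coe_sub, expReward]
  congr 1
  · rw [EReal.coe_ennreal_toReal]
    · congr 1
      refine lintegral_congr_ae ?_
      filter_upwards [hae] with π hπ
      rw [hπ, EReal.toENNReal_of_ne_top (EReal.coe_ne_top _), EReal.toReal_coe]
    · exact hX.lintegral_lt_top.ne
  · rw [EReal.coe_ennreal_toReal]
    · congr 1
      refine lintegral_congr_ae ?_
      filter_upwards [hae] with π hπ
      rw [hπ, ← EReal.coe_neg, EReal.toENNReal_of_ne_top (EReal.coe_ne_top _), EReal.toReal_coe]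
    · exact hX.neg.lintegral_lt_top.ne

/-- The expected reward is `∞` if the target is missed with positive probability and the time
spent before reaching the target has finite expectation on the paths that reach it. The second
condition makes the negative part integrable; without it the expectation could be `⊤ - ⊤ = ⊥`. -/
theorem expReward_eq_top {M : MDP S A AP} (μ : M.Scheduler) (B : Set AP → Prop)
    (ρ : S → A → ℝ) {δ : ℝ} (hδ : 0 < δ)
    (hlow : ∀ t, δ ≤ M.killedValue (M.liveSet B) μ.weight (fun _ _ => 1) t)
    {c : ℕ → ℝ} (hc : Summable c)
    (hdiff : ∀ t N, t ≤ N → M.killedValue (M.liveSet B) μ.weight (fun _ _ => 1) t -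
      M.killedValue (M.liveSet B) μ.weight (fun _ _ => 1) N ≤ c t) :
    M.expReward ρ B μ = ⊤ := by
  set G := M.liveSet B with hG
  simp_rw [← measureReal_aliveSet] at hlow hdiff
  set E : Set (ℕ → Step S A) := ⋂ t, aliveSet A G t with hE
  have hEm : MeasurableSet E := MeasurableSet.iInter fun t => measurableSet_aliveSet G t
  have hlim : Tendsto (fun N => (pathMeasure μ).real (aliveSet A G N)) atTop
      (𝓝 ((pathMeasure μ).real E)) := by
    refine (ENNReal.tendsto_toReal (measure_ne_top _ _)).comp
      (tendsto_measure_iInter_atTop (fun t => (measurableSet_aliveSet G t).nullMeasurableSet)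
        (aliveSet_antitone G) ⟨0, measure_ne_top _ _⟩)
  have hEpos : 0 < (pathMeasure μ).real E := hδ.trans_le (ge_of_tendsto' hlim hlow)
  have hle : ∀ t, (pathMeasure μ).real (aliveSet A G t \ E) ≤ c t := by
    intro t
    rw [measureReal_sdiff (Set.iInter_subset _ t) hEm]
    refine le_of_tendsto (tendsto_const_nhds.sub hlim) ?_
    filter_upwards [eventually_ge_atTop t] with N hN using hdiff t N hN
  obtain ⟨C, hC0, hC⟩ := norm_le_const (fun x : Step S A => ρ x.state x.action)
  -- The reward is `∞` on the event `E` of positive probability.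
  have hpos : ∫⁻ π, (M.pathReward ρ B π).toENNReal ∂pathMeasure μ = ⊤ := by
    rw [eq_top_iff]
    calc (⊤ : ℝ≥0∞) = ∫⁻ π, E.indicator (fun _ => ⊤) π ∂pathMeasure μ := by
          rw [lintegral_indicator_const hEm, ENNReal.top_mul]
          intro h0
          rw [Measure.real, h0] at hEpos
          simp at hEpos
      _ ≤ _ := by
          refine lintegral_mono fun π => ?_
          by_cases h : π ∈ E
          · rw [pathReward_eq_top M ρ B fun t => Set.mem_iInter.1 h t]
            simp
          · simp [h]
  -- Outside of `E`, the negative part is at most `C` times the number of entries before the target.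
  have hneg : ∫⁻ π, (-M.pathReward ρ B π).toENNReal ∂pathMeasure μ ≠ ⊤ := by
    have hb : ∀ π, (-M.pathReward ρ B π).toENNReal ≤
        ∑' t, (aliveSet A G t \ E).indicator (fun _ => ENNReal.ofReal C) π := by
      intro π
      by_cases h : π ∈ E
      · rw [pathReward_eq_top M ρ B fun t => Set.mem_iInter.1 h t]
        simp
      · obtain ⟨t₀, ht₀⟩ : ∃ t, π ∉ aliveSet A G t := by simpa [E] using h
        have hz : ∀ t, t ∉ Finset.range t₀ → π ∉ aliveSet A G t := by
          intro t ht h'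
          exact ht₀ (aliveSet_antitone G (by simpa using ht) h')
        rw [pathReward_eq_tsum M ρ B ht₀, ← EReal.coe_neg,
          EReal.toENNReal_of_ne_top (EReal.coe_ne_top _), EReal.toReal_coe,
          tsum_eq_sum (s := Finset.range t₀), tsum_eq_sum (s := Finset.range t₀)]
        · rw [← Finset.sum_neg_distrib]
          calc _ ≤ ENNReal.ofReal (∑ t ∈ Finset.range t₀,
                (aliveSet A G t \ E).indicator (fun _ => C) π) := by
                refine ENNReal.ofReal_le_ofReal (Finset.sum_le_sum fun t _ => ?_)
                by_cases h' : π ∈ aliveSet A G t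
                · simp only [G] at h' h ⊢
                  simpa [h', h] using (neg_le_abs _).trans (hC (π t))
                · simp only [G] at h' h ⊢
                  simp [h']
            _ = _ := by
                rw [ENNReal.ofReal_sum_of_nonneg]
                · refine Finset.sum_congr rfl fun t _ => ?_
                  by_cases h' : π ∈ aliveSet A G t \ E <;>
                    simp only [h', not_false_eq_true, Set.indicator_of_mem,
                      Set.indicator_of_notMem, ENNReal.ofReal_zero]
                · intro t _
                  exact Set.indicator_nonneg (fun _ _ => hC0) _
        · intro t ht
          exact Set.indicator_of_notMem (fun h' => hz t ht h'.1) _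
        · intro t ht
          exact Set.indicator_of_notMem (hz t ht) _
    refine ((lintegral_mono hb).trans_lt ?_).ne
    rw [lintegral_tsum fun t => (measurable_const.indicator
      ((measurableSet_aliveSet G t).diff hEm)).aemeasurable]
    simp_rw [fun t => lintegral_indicator_const (μ := pathMeasure μ)
      ((measurableSet_aliveSet G t).diff hEm) (ENNReal.ofReal C)]
    rw [ENNReal.tsum_mul_left]
    refine ENNReal.mul_lt_top ENNReal.ofReal_lt_top ?_
    calc _ ≤ ∑' t, ENNReal.ofReal (c t) := by
          refine ENNReal.tsum_le_tsum fun t => ?_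
          rw [← ofReal_measureReal]
          exact ENNReal.ofReal_le_ofReal (hle t)
      _ < ⊤ := hc.tsum_ofReal_lt_top
  rw [expReward, hpos]
  lift (∫⁻ π, (-M.pathReward ρ B π).toENNReal ∂pathMeasure μ) to ℝ≥0 using hneg with x
  rfl

end MDP
end MORAP

namespace MORAP
open Matrix Filter Topology

/-! ### Substochastic matrices -/

section Substochastic

/-- A nonnegative matrix all of whose rows have a sum of at most one. -/
structure IsSubstochastic {S : Type*} [Fintype S] (T : Matrix S S ℝ) : Prop where
  nonneg : ∀ i j, 0 ≤ T i j
  sum_le_one : ∀ i, ∑ j, T i j ≤ 1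

/-- The matrix `1 - T` is injective. For a substochastic `T` this means that the chain is killed
almost surely from every state. -/
def IsTransient {S : Type*} [Fintype S] (T : Matrix S S ℝ) : Prop := ∀ f, T *ᵥ f = f → f = 0

variable {S : Type*} [Fintype S] {T : Matrix S S ℝ}

theorem IsSubstochastic.mulVec_mono (hT : IsSubstochastic T) {f g : S → ℝ} (h : f ≤ g) :
    T *ᵥ f ≤ T *ᵥ g := fun i =>
  Finset.sum_le_sum fun j _ => mul_le_mul_of_nonneg_left (h j) (hT.nonneg i j)

theorem IsSubstochastic.pow_mulVec_mono [DecidableEq S] (hT : IsSubstochastic T) (t : ℕ)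
    {f g : S → ℝ} (h : f ≤ g) : T ^ t *ᵥ f ≤ T ^ t *ᵥ g := by
  induction t with
  | zero => simpa using h
  | succ t ih =>
    rw [pow_succ', ← mulVec_mulVec, ← mulVec_mulVec]
    exact hT.mulVec_mono ih

/-- Maximum principle: the states at which a nonzero harmonic function has maximal absolute
value form a closed set of states. -/
theorem IsSubstochastic.exists_closed (hT : IsSubstochastic T) {f : S → ℝ} (hf : T *ᵥ f = f)
    (h0 : f ≠ 0) : ∃ X : Set S, X.Nonempty ∧ (∀ s ∈ X, f s ≠ 0) ∧
      ∀ s ∈ X, ∀ s', T s s' ≠ 0 → s' ∈ X := by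
  obtain ⟨s₁, hs₁⟩ := Function.ne_iff.1 h0
  obtain ⟨s₀, -, hs₀⟩ :=
    Finset.exists_max_image Finset.univ (fun s => |f s|) ⟨s₁, Finset.mem_univ _⟩
  have hpos : 0 < |f s₀| := (abs_pos.2 hs₁).trans_le (hs₀ s₁ (Finset.mem_univ _))
  refine ⟨{s | |f s| = |f s₀|}, ⟨s₀, by simp⟩, fun s hs => ?_, fun s hs s' hss' => ?_⟩
  · simp only [Set.mem_ofPred_eq] at hs
    exact abs_pos.1 (hs ▸ hpos)
  · simp only [Set.mem_ofPred_eq] at hs ⊢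
    by_contra hne
    have hlt : |f s'| < |f s₀| := lt_of_le_of_ne (hs₀ s' (Finset.mem_univ _)) hne
    have h1 : |f s| < |f s₀| := by
      calc |f s| = |∑ j, T s j * f j| := by
            conv_lhs => rw [← hf]
            rfl
        _ ≤ ∑ j, T s j * |f j| := by
            refine (Finset.abs_sum_le_sum_abs _ _).trans (Finset.sum_le_sum fun j _ => ?_)
            rw [abs_mul, abs_of_nonneg (hT.nonneg s j)]
        _ < ∑ j, T s j * |f s₀| := by
            refine Finset.sum_lt_sum (fun j _ => mul_le_mul_of_nonneg_left
              (hs₀ j (Finset.mem_univ _)) (hT.nonneg s j)) ⟨s', Finset.mem_univ _, ?_⟩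
            exact mul_lt_mul_of_pos_left hlt ((hT.nonneg s s').lt_of_ne' hss')
        _ ≤ |f s₀| := by
            rw [← Finset.sum_mul]
            exact mul_le_of_le_one_left hpos.le (hT.sum_le_one s)
    exact h1.ne hs

theorem IsTransient.det_ne_zero [DecidableEq S] (hT : IsTransient T) : (1 - T).det ≠ 0 := by
  intro h
  obtain ⟨v, hv, h0⟩ := exists_mulVec_eq_zero_iff.2 h
  refine hv (hT v ?_)
  rw [sub_mulVec, one_mulVec, sub_eq_zero] at h0
  exact h0.symm

theorem IsTransient.eq_inv_mulVec [DecidableEq S] (hT : IsTransient T) (r : S → ℝ) :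
    (1 - T)⁻¹ *ᵥ r = r + T *ᵥ ((1 - T)⁻¹ *ᵥ r) := by
  have h : (1 - T) *ᵥ ((1 - T)⁻¹ *ᵥ r) = r := by
    rw [mulVec_mulVec, mul_nonsing_inv _ hT.det_ne_zero.isUnit, one_mulVec]
  rw [sub_mulVec, one_mulVec] at h
  exact sub_eq_iff_eq_add.1 h

theorem IsTransient.unique (hT : IsTransient T) {r V W : S → ℝ} (hV : V = r + T *ᵥ V)
    (hW : W = r + T *ᵥ W) : V = W := by
  refine sub_eq_zero.1 (hT _ ?_)
  rw [mulVec_sub]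
  conv_rhs => rw [hV, hW]
  abel

theorem eq_sum_pow_add [DecidableEq S] {r V : S → ℝ} (hV : V = r + T *ᵥ V) (N : ℕ) :
    V = ∑ t ∈ Finset.range N, T ^ t *ᵥ r + T ^ N *ᵥ V := by
  induction N with
  | zero => simp
  | succ N ih =>
    conv_lhs => rw [ih, hV, mulVec_add]
    rw [Finset.sum_range_succ, pow_succ, ← mulVec_mulVec, add_assoc]

/-- The solution `W` of `W = 1 + T W`, the expected lifetime, is nonnegative by the minimum
principle and therefore bounds all partial sums of `∑ t, Tᵗ 1`. -/
theorem IsTransient.summable [DecidableEq S] (hT : IsTransient T) (hS : IsSubstochastic T)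
    (r : S → ℝ) (s : S) : Summable fun t => (T ^ t *ᵥ r) s := by
  set W := (1 - T)⁻¹ *ᵥ (1 : S → ℝ) with hWdef
  have hW : W = 1 + T *ᵥ W := hT.eq_inv_mulVec 1
  have hW0 : 0 ≤ W := by
    obtain ⟨s₀, -, hs₀⟩ := Finset.exists_min_image Finset.univ W ⟨s, Finset.mem_univ _⟩
    intro s'
    refine le_trans ?_ (hs₀ s' (Finset.mem_univ _))
    by_contra hneg
    simp only [Pi.zero_apply, not_le] at hneg
    have h1 : W s₀ ≤ (T *ᵥ W) s₀ := by
      calc W s₀ ≤ ∑ j, T s₀ j * W s₀ := by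
            rw [← Finset.sum_mul]
            nlinarith [hS.sum_le_one s₀]
        _ ≤ _ := Finset.sum_le_sum fun j _ =>
            mul_le_mul_of_nonneg_left (hs₀ j (Finset.mem_univ _)) (hS.nonneg s₀ j)
    have h2 := congrFun hW s₀
    simp only [Pi.add_apply, Pi.one_apply] at h2
    linarith
  have h1 : Summable fun t => (T ^ t *ᵥ (1 : S → ℝ)) s := by
    refine summable_of_sum_range_le (c := W s) (fun t => ?_) fun N => ?_
    · have := hS.pow_mulVec_mono t (f := 0) (g := 1) (fun _ => zero_le_one) s
      simpa using this
    · have h2 := congrFun (eq_sum_pow_add hW N) s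
      have h3 := hS.pow_mulVec_mono N hW0 s
      simp only [mulVec_zero, Pi.zero_apply] at h3
      simp only [Pi.add_apply, Finset.sum_apply] at h2
      linarith
  set C := ∑ s, |r s|
  have hC : ∀ s, |r s| ≤ C := fun s =>
    Finset.single_le_sum (f := fun s => |r s|) (fun _ _ => abs_nonneg _) (Finset.mem_univ s)
  refine Summable.of_norm_bounded (h1.mul_left C) fun t => ?_
  have hu := hS.pow_mulVec_mono t (f := r) (g := C • 1)
    (fun s => by simpa using (le_abs_self _).trans (hC s)) s
  have hl := hS.pow_mulVec_mono t (f := (-C) • 1) (g := r)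
    (fun s => by simpa using neg_le_of_abs_le (hC s)) s
  rw [mulVec_smul, Pi.smul_apply, smul_eq_mul] at hu hl
  rw [Real.norm_eq_abs, abs_le]
  exact ⟨by linarith, hu⟩

theorem IsTransient.hasSum [DecidableEq S] (hT : IsTransient T) (hS : IsSubstochastic T)
    {r V : S → ℝ} (hV : V = r + T *ᵥ V) (s : S) : HasSum (fun t => (T ^ t *ᵥ r) s) (V s) := by
  have h := (hT.summable hS r s).hasSum
  convert h using 1
  refine tendsto_nhds_unique ?_ h.tendsto_sum_nat
  have h2 : ∀ N, ∑ t ∈ Finset.range N, (T ^ t *ᵥ r) s = V s - (T ^ N *ᵥ V) s := by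
    intro N
    have := congrFun (eq_sum_pow_add hV N) s
    simp only [Pi.add_apply, Finset.sum_apply] at this
    linarith
  simp_rw [h2]
  simpa using tendsto_const_nhds.sub (hT.summable hS V s).tendsto_atTop_zero

end Substochastic

/-! ### Policies and their values -/

namespace MDP
variable {S A AP : Type*} [Fintype S]

theorem toReal_next {M : MDP S A AP} {s : S} {a : A} (h : a ∈ M.enabled s) (s' : S) :
    (M.next s a s').toReal = M.P s a s' := by
  simp [next, h]

theorem sum_toReal_next (M : MDP S A AP) (s : S) (a : A) :
    ∑ s', (M.next s a s').toReal = 1 := by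
  rw [← ENNReal.toReal_sum fun a _ => PMF.apply_ne_top _ _,
      ← tsum_fintype (L := .unconditional _),
    PMF.tsum_coe, ENNReal.toReal_one]

variable [Fintype A]

/-- The schedulers as points of the finite-dimensional space `S → A → ℝ`. -/
def policies (M : MDP S A AP) : Set (S → A → ℝ) :=
  {p | (∀ s, p s ∈ stdSimplex ℝ A) ∧
    ∀ s, (M.enabled s).Nonempty → ∀ a ∉ M.enabled s, p s a = 0}

theorem Scheduler.weight_mem {M : MDP S A AP} (μ : M.Scheduler) : μ.weight ∈ M.policies := by
  refine ⟨fun s => ⟨fun a => ENNReal.toReal_nonneg, ?_⟩, fun s hs a ha => ?_⟩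
  · simp only [weight]
    rw [← ENNReal.toReal_sum fun a _ => PMF.apply_ne_top _ _,
      ← tsum_fintype (L := .unconditional _),
      PMF.tsum_coe, ENNReal.toReal_one]
  · have : a ∉ (μ.choice s).support := fun h => ha (μ.support_subset s hs h)
    simp [weight, (PMF.apply_eq_zero_iff _ _).2 this]

/-- A policy chooses the only enabled action with probability one. -/
theorem sum_policy_eq_single {M : MDP S A AP} {p : S → A → ℝ}
    (hp : p ∈ M.policies) {s : S} {c : A} (hc : c ∈ M.enabled s)
    (h : ∀ a ∈ M.enabled s, a = c) (g : A → ℝ) : ∑ a, p s a * g a = g c := by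
  have h0 : ∀ a, a ≠ c → p s a = 0 := fun a hac => hp.2 s ⟨c, hc⟩ a fun ha => hac (h a ha)
  have h1 : p s c = 1 := by
    rw [← (hp.1 s).2, Finset.sum_eq_single c (fun a _ hac => h0 a hac) (by simp)]
  rw [Finset.sum_eq_single c (fun a _ hac => by rw [h0 a hac, zero_mul]) (by simp), h1, one_mul]

theorem exists_weight_eq {M : MDP S A AP} {p : S → A → ℝ} (hp : p ∈ M.policies) :
    ∃ μ : M.Scheduler, μ.weight = p := by
  refine ⟨⟨fun s => PMF.ofFintype (fun a => ENNReal.ofReal (p s a)) ?_, fun s hs a ha => ?_⟩, ?_⟩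
  · rw [← ENNReal.ofReal_sum_of_nonneg fun a _ => (hp.1 s).1 a, (hp.1 s).2, ENNReal.ofReal_one]
  · by_contra hne
    simp [hp.2 s hs a hne] at ha
  · ext s a
    simp [Scheduler.weight, (hp.1 s).1 a]

theorem isSubstochastic_killedMatrix (M : MDP S A AP) (G : Set S) {p : S → A → ℝ}
    (hp : p ∈ M.policies) : IsSubstochastic (M.killedMatrix G p) := by
  refine ⟨fun i j => ?_, fun i => ?_⟩
  · unfold killedMatrix
    split_ifs
    · exact Finset.sum_nonneg fun a _ => mul_nonneg ((hp.1 i).1 a) ENNReal.toReal_nonneg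
    · exact le_rfl
  · unfold killedMatrix
    split_ifs
    · rw [Finset.sum_comm]
      simp_rw [← Finset.mul_sum, sum_toReal_next, mul_one]
      exact (hp.1 i).2.le
    · simp

theorem killedMatrix_mulVec_apply (M : MDP S A AP) (G : Set S) (p : S → A → ℝ) (f : S → ℝ)
    {s : S} (hs : s ∈ G) : (M.killedMatrix G p *ᵥ f) s =
      ∑ a, p s a * ∑ s', (M.next s a s').toReal * f s' := by
  simp only [mulVec, dotProduct, killedMatrix, if_pos hs, Finset.sum_mul, Finset.mul_sum]
  rw [Finset.sum_comm]
  simp [mul_assoc]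

theorem killedMatrix_mulVec_apply_of_notMem (M : MDP S A AP) (G : Set S) (p : S → A → ℝ)
    (f : S → ℝ) {s : S} (hs : s ∉ G) : (M.killedMatrix G p *ᵥ f) s = 0 := by
  simp [mulVec, dotProduct, killedMatrix, hs]

theorem killedMatrix_ne_zero (M : MDP S A AP) {G : Set S} {p : S → A → ℝ} (hp : p ∈ M.policies)
    {s s' : S} (hs : s ∈ G) {a : A} (ha : a ∈ M.enabled s) (hpa : p s a ≠ 0)
    (hP : M.P s a s' ≠ 0) : M.killedMatrix G p s s' ≠ 0 := by
  simp only [killedMatrix, if_pos hs]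
  refine ne_of_gt (Finset.sum_pos' (fun a _ => mul_nonneg ((hp.1 s).1 a) ENNReal.toReal_nonneg)
    ⟨a, Finset.mem_univ _, mul_pos (((hp.1 s).1 a).lt_of_ne' hpa) ?_⟩)
  rw [toReal_next ha]
  exact NNReal.coe_pos.2 (pos_iff_ne_zero.2 hP)

/-- `R` is a set of states that contains the initial state and cannot be left before the target
`B` is reached, and under every policy the chain killed outside of `R` and in the target is
transient. -/
structure IsProper (M : MDP S A AP) (B : Set AP → Prop) (R : Set S) : Prop where
  init_mem : M.init ∈ R
  closed : ∀ s ∈ R, ¬ B (M.label s) → ∀ a ∈ M.enabled s, ∀ s', M.P s a s' ≠ 0 → s' ∈ R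
  transient : ∀ p ∈ M.policies, IsTransient (M.killedMatrix (R ∩ M.liveSet B) p)

/-- Starting in `R`, killing in the target only or also outside of `R` makes no difference. -/
theorem IsProper.killedMatrix_congr {M : MDP S A AP} {B : Set AP → Prop} {R : Set S}
    (hR : M.IsProper B R) {p : S → A → ℝ} (hp : p ∈ M.policies) {f g : S → ℝ}
    (h : ∀ s ∈ R, f s = g s) (s : S) (hs : s ∈ R) :
    (M.killedMatrix (M.liveSet B) p *ᵥ f) s = (M.killedMatrix (R ∩ M.liveSet B) p *ᵥ g) s := by
  by_cases hl : s ∈ M.liveSet B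
  · rw [killedMatrix_mulVec_apply _ _ _ _ hl,
      killedMatrix_mulVec_apply _ _ _ _ (Set.mem_inter hs hl)]
    refine Finset.sum_congr rfl fun a _ => ?_
    by_cases ha : a ∈ M.enabled s
    · congr 1
      refine Finset.sum_congr rfl fun s' _ => ?_
      rw [toReal_next ha]
      by_cases h0 : M.P s a s' = 0
      · simp [h0]
      · rw [h s' (hR.closed s hs hl a ha s' h0)]
    · by_cases hne : (M.enabled s).Nonempty
      · rw [hp.2 s hne a ha, zero_mul, zero_mul]
      · congr 1
        classical
        have : ∀ s', (M.next s a s').toReal = if s' = s then 1 else 0 := by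
          intro s'
          simp only [next, dif_neg ha, PMF.pure_apply]
          split_ifs <;> simp
        simp [this, h s hs]
  · rw [killedMatrix_mulVec_apply_of_notMem _ _ _ _ hl,
      killedMatrix_mulVec_apply_of_notMem _ _ _ _ fun h' => hl h'.2]

theorem IsProper.killedValue_eq [DecidableEq S] {M : MDP S A AP} {B : Set AP → Prop} {R : Set S}
    (hR : M.IsProper B R) {p : S → A → ℝ} (hp : p ∈ M.policies) (ρ : S → A → ℝ) (t : ℕ) :
    M.killedValue (M.liveSet B) p ρ t = M.killedValue (R ∩ M.liveSet B) p ρ t := by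
  suffices h : ∀ s ∈ R, (M.killedMatrix (M.liveSet B) p ^ t *ᵥ killedReward (M.liveSet B) p ρ) s =
      (M.killedMatrix (R ∩ M.liveSet B) p ^ t *ᵥ killedReward (R ∩ M.liveSet B) p ρ) s from
    h _ hR.init_mem
  induction t with
  | zero =>
    intro s hs
    by_cases hl : s ∈ M.liveSet B <;> simp [killedReward, hs, hl]
  | succ t ih =>
    simp_rw [pow_succ', ← mulVec_mulVec]
    exact hR.killedMatrix_congr hp ih

/-- The value equations of the policy `p` for the reward structure `ρ`, with value zero outside
of `G`. -/
structure IsValue (M : MDP S A AP) (G : Set S) (p ρ : S → A → ℝ) (V : S → ℝ) : Prop where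
  eq_sum : ∀ s ∈ G, V s = ∑ a, p s a * (ρ s a + ∑ s', (M.next s a s').toReal * V s')
  eq_zero : ∀ s ∉ G, V s = 0

theorem isValue_iff {M : MDP S A AP} {G : Set S} {p ρ : S → A → ℝ} {V : S → ℝ} :
    M.IsValue G p ρ V ↔ V = killedReward G p ρ + M.killedMatrix G p *ᵥ V := by
  have h1 : ∀ s ∈ G, (killedReward G p ρ + M.killedMatrix G p *ᵥ V) s =
      ∑ a, p s a * (ρ s a + ∑ s', (M.next s a s').toReal * V s') := fun s hs => by
    rw [Pi.add_apply, killedMatrix_mulVec_apply _ _ _ _ hs, killedReward, if_pos hs,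
      ← Finset.sum_add_distrib]
    simp_rw [mul_add]
  have h2 : ∀ s ∉ G, (killedReward G p ρ + M.killedMatrix G p *ᵥ V) s = 0 := fun s hs => by
    rw [Pi.add_apply, killedMatrix_mulVec_apply_of_notMem _ _ _ _ hs, killedReward, if_neg hs,
      add_zero]
  refine ⟨fun h => funext fun s => ?_, fun h => ⟨fun s hs => ?_, fun s hs => ?_⟩⟩
  · by_cases hs : s ∈ G
    · rw [h1 s hs, h.eq_sum s hs]
    · rw [h2 s hs, h.eq_zero s hs]
  · rw [← h1 s hs, ← h]
  · rw [h, h2 s hs]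

/-- In a proper MDP, the expected reward is the value at the initial state of any solution of
the value equations. -/
theorem IsProper.expReward_eq {M : MDP S A AP} {B : Set AP → Prop} {R : Set S}
    (hR : M.IsProper B R) (μ : M.Scheduler) {ρ : S → A → ℝ} {V : S → ℝ}
    (hV : M.IsValue (R ∩ M.liveSet B) μ.weight ρ V) :
    M.expReward ρ B μ = (V M.init : EReal) := by
  classical
  have hT := hR.transient _ μ.weight_mem
  have hS := M.isSubstochastic_killedMatrix (R ∩ M.liveSet B) μ.weight_mem
  have hk := hR.killedValue_eq μ.weight_mem
  rw [expReward_eq_tsum]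
  · simp_rw [hk]
    rw [(hT.hasSum hS (isValue_iff.1 hV) M.init).tsum_eq.symm]
    rfl
  · exact (hT.summable hS _ M.init).congr fun t => (hk _ t).symm

/-- The solution `(1 - T)⁻¹ r` of the value equations, meaningful only if `1 - T` is invertible. -/
noncomputable def policyValue (M : MDP S A AP) (G : Set S) (p ρ : S → A → ℝ) : S → ℝ :=
  letI := Classical.decEq S
  (1 - M.killedMatrix G p)⁻¹ *ᵥ killedReward G p ρ

theorem policyValue_zero (M : MDP S A AP) (G : Set S)
    (p : S → A → ℝ) : M.policyValue G p 0 = 0 := by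
  have : killedReward G p (0 : S → A → ℝ) = 0 := by
    ext s
    simp [killedReward]
  rw [policyValue, this, Matrix.mulVec_zero]

theorem policyValue_congr (M : MDP S A AP) {G : Set S}
    {p p' : S → A → ℝ} (h : ∀ s ∈ G, p s = p' s) (ρ : S → A → ℝ) :
    M.policyValue G p ρ = M.policyValue G p' ρ := by
  have h1 : M.killedMatrix G p = M.killedMatrix G p' := by
    ext s s'
    by_cases hs : s ∈ G <;> simp [killedMatrix, hs, h]
  have h2 : killedReward G p ρ = killedReward G p' ρ := by
    ext s
    by_cases hs : s ∈ G <;> simp [killedReward, hs, h]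
  rw [policyValue, policyValue, h1, h2]

theorem policyValue_sum {κ : Type*} [Fintype κ]
    (M : MDP S A AP) (G : Set S) (p : S → A → ℝ) (w : κ → ℝ) (ρ : κ → S → A → ℝ) :
    M.policyValue G p (fun s a => ∑ k, w k * ρ k s a) =
      ∑ k, w k • M.policyValue G p (ρ k) := by
  have h : killedReward G p (fun s a => ∑ k, w k * ρ k s a) =
      ∑ k, w k • killedReward G p (ρ k) := by
    ext s
    by_cases hs : s ∈ G
    · simp only [killedReward, if_pos hs, Finset.sum_apply, Pi.smul_apply, smul_eq_mul,
        Finset.mul_sum]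
      rw [Finset.sum_comm]
      refine Finset.sum_congr rfl fun k _ => Finset.sum_congr rfl fun a _ => by ring
    · simp [killedReward, hs]
  simp_rw [policyValue, h, Matrix.mulVec_sum, Matrix.mulVec_smul]

theorem IsProper.isValue_policyValue {M : MDP S A AP} {B : Set AP → Prop} {R : Set S}
    (hR : M.IsProper B R) {p : S → A → ℝ} (hp : p ∈ M.policies) (ρ : S → A → ℝ) :
    M.IsValue (R ∩ M.liveSet B) p ρ (M.policyValue (R ∩ M.liveSet B) p ρ) := by
  let := Classical.decEq S
  exact isValue_iff.2 <| (hR.transient p hp).eq_inv_mulVec _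

theorem IsProper.eq_policyValue {M : MDP S A AP} {B : Set AP → Prop} {R : Set S}
    (hR : M.IsProper B R) {p : S → A → ℝ} (hp : p ∈ M.policies) {ρ : S → A → ℝ} {V : S → ℝ}
    (hV : M.IsValue (R ∩ M.liveSet B) p ρ V) : V = M.policyValue (R ∩ M.liveSet B) p ρ :=
  (hR.transient p hp).unique (isValue_iff.1 hV) (isValue_iff.1 (hR.isValue_policyValue hp ρ))

theorem IsProper.expReward_eq_policyValue {M : MDP S A AP} {B : Set AP → Prop} {R : Set S}
    (hR : M.IsProper B R) (μ : M.Scheduler) (ρ : S → A → ℝ) :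
    M.expReward ρ B μ = (M.policyValue (R ∩ M.liveSet B) μ.weight ρ M.init : EReal) :=
  hR.expReward_eq μ (hR.isValue_policyValue μ.weight_mem ρ)

theorem IsProper.continuousOn_policyValue {M : MDP S A AP} {B : Set AP → Prop} {R : Set S}
    (hR : M.IsProper B R) (ρ : S → A → ℝ) :
    ContinuousOn (fun p => M.policyValue (R ∩ M.liveSet B) p ρ M.init) M.policies := by
  let := Classical.decEq S
  have h1 : Continuous fun p : S → A → ℝ => 1 - M.killedMatrix (R ∩ M.liveSet B) p := by
    refine continuous_const.sub (continuous_matrix fun i j => ?_)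
    unfold killedMatrix
    split_ifs <;> fun_prop
  have h2 : Continuous fun p : S → A → ℝ => killedReward (R ∩ M.liveSet B) p ρ := by
    refine continuous_pi fun s => ?_
    unfold killedReward
    split_ifs <;> fun_prop
  have h3 : ContinuousOn (fun p : S → A → ℝ => (1 - M.killedMatrix (R ∩ M.liveSet B) p)⁻¹)
      M.policies := by
    simp_rw [Matrix.inv_def, Ring.inverse_eq_inv']
    exact (h1.matrix_det.continuousOn.inv₀ fun p hp => (hR.transient p hp).det_ne_zero).smul
      h1.matrix_adjugate.continuousOn
  have h4 : ContinuousOn (fun p => M.policyValue (R ∩ M.liveSet B) p ρ) M.policies := by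
    have hc : Continuous fun z : Matrix S S ℝ × (S → ℝ) => z.1 *ᵥ z.2 :=
      continuous_fst.matrix_mulVec continuous_snd
    exact hc.comp_continuousOn (h3.prodMk h2.continuousOn)
  exact (continuous_apply M.init).comp_continuousOn h4

theorem isCompact_policies (M : MDP S A AP) : IsCompact M.policies := by
  have h : M.policies = Set.pi Set.univ (fun _ : S => stdSimplex ℝ A) ∩
      ⋂ s, ⋂ (_ : (M.enabled s).Nonempty), ⋂ a, ⋂ (_ : a ∉ M.enabled s), {p | p s a = 0} := by
    ext p
    simp [policies]
  rw [h]
  refine (isCompact_univ_pi fun _ => isCompact_stdSimplex ℝ A).inter_right ?_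
  refine isClosed_iInter fun s => isClosed_iInter fun _ => isClosed_iInter fun a =>
    isClosed_iInter fun _ => isClosed_eq (by fun_prop) continuous_const

theorem convex_policies (M : MDP S A AP) : Convex ℝ M.policies := by
  intro p hp q hq a b ha hb hab
  refine ⟨fun s => convex_stdSimplex ℝ A (hp.1 s) (hq.1 s) ha hb hab, fun s hs c hc => ?_⟩
  simp [hp.2 s hs c hc, hq.2 s hs c hc]

/-- The value is a continuous function on the compact set of policies. -/
theorem IsProper.exists_isOptimal {M : MDP S A AP} {B : Set AP → Prop} {R : Set S}
    (hR : M.IsProper B R) (hne : M.policies.Nonempty) (ρ : S → A → ℝ) :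
    ∃ μ, M.IsOptimal ρ B μ := by
  obtain ⟨p, hp, hmax⟩ := M.isCompact_policies.exists_isMaxOn hne (hR.continuousOn_policyValue ρ)
  obtain ⟨μ, rfl⟩ := exists_weight_eq hp
  refine ⟨μ, fun μ' => ?_⟩
  rw [hR.expReward_eq_policyValue, hR.expReward_eq_policyValue]
  exact EReal.coe_le_coe_iff.2 (hmax μ'.weight_mem)

/-- The policies form a compact connected set, so their values fill a compact interval. -/
theorem IsProper.exists_expReward_eq {M : MDP S A AP} {B : Set AP → Prop} {R : Set S}
    (hR : M.IsProper B R) (hne : M.policies.Nonempty) (ρ : S → A → ℝ) :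
    ∃ m m' : ℝ, (∀ p ∈ M.policies, M.policyValue (R ∩ M.liveSet B) p ρ M.init ∈ Set.Icc m m') ∧
      ∀ z ∈ Set.Icc m m', ∃ μ, M.expReward ρ B μ = (z : EReal) := by
  have hc := hR.continuousOn_policyValue ρ
  obtain ⟨p, hp, hmax⟩ := M.isCompact_policies.exists_isMaxOn hne hc
  obtain ⟨q, hq, hmin⟩ := M.isCompact_policies.exists_isMinOn hne hc
  refine ⟨_, _, fun p' hp' => ⟨hmin hp', hmax hp'⟩, fun z hz => ?_⟩
  obtain ⟨p', hp', rfl⟩ := M.convex_policies.isPreconnected.intermediate_value hq hp hc hz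
  obtain ⟨μ, rfl⟩ := exists_weight_eq hp'
  exact ⟨μ, hR.expReward_eq_policyValue μ ρ⟩

end MDP
end MORAP

namespace MORAP
open Matrix Filter Topology
/-! ### Reward-finite MDPs are proper -/

namespace MDP
variable {S A AP : Type*} [Fintype S]

/-- A set of states disjoint from the target in which some policy remains forever. -/
def IsTrapSet (M : MDP S A AP) (B : Set AP → Prop) (X : Set S) : Prop :=
  X ⊆ M.liveSet B ∧ ∀ s ∈ X, ∃ a ∈ M.enabled s, ∀ s', M.P s a s' ≠ 0 → s' ∈ X

/-- The largest trap set. -/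
def trapRegion (M : MDP S A AP) (B : Set AP → Prop) : Set S := ⋃₀ {X | M.IsTrapSet B X}

theorem isTrapSet_trapRegion (M : MDP S A AP) (B : Set AP → Prop) :
    M.IsTrapSet B (M.trapRegion B) := by
  refine ⟨Set.sUnion_subset fun X hX => hX.1, fun s hs => ?_⟩
  obtain ⟨X, hX, hsX⟩ := Set.mem_sUnion.1 hs
  obtain ⟨a, ha, h⟩ := hX.2 s hsX
  exact ⟨a, ha, fun s' hs' => Set.mem_sUnion.2 ⟨X, hX, h s' hs'⟩⟩

variable [Fintype A]

theorem exists_enabled_weight_ne_zero {M : MDP S A AP} {p : S → A → ℝ} (hp : p ∈ M.policies)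
    {s : S} (hs : (M.enabled s).Nonempty) : ∃ a ∈ M.enabled s, p s a ≠ 0 := by
  by_contra! h
  have h0 : ∀ a, p s a = 0 := fun a => by
    by_cases ha : a ∈ M.enabled s
    · exact h a ha
    · exact hp.2 s hs a ha
  have := (hp.1 s).2
  simp [h0] at this

/-- A chain killed outside of a set that meets no trap set is transient, because the maximum
principle would otherwise provide a trap set inside of it. -/
theorem isTransient_of_disjoint_trapRegion {M : MDP S A AP} {B : Set AP → Prop}
    (hen : ∀ s, (M.enabled s).Nonempty) {G : Set S} (hG : G ⊆ M.liveSet B)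
    (hd : ∀ s ∈ G, s ∉ M.trapRegion B) {p : S → A → ℝ} (hp : p ∈ M.policies) :
    IsTransient (M.killedMatrix G p) := by
  intro f hf
  by_contra h0
  obtain ⟨X, ⟨x, hx⟩, hXf, hX⟩ := (M.isSubstochastic_killedMatrix G hp).exists_closed hf h0
  have hXG : ∀ s ∈ X, s ∈ G := by
    intro s hs
    by_contra hsG
    exact hXf s hs (hf ▸ M.killedMatrix_mulVec_apply_of_notMem G p f hsG)
  have hXt : M.IsTrapSet B X := by
    refine ⟨fun s hs => hG (hXG s hs), fun s hs => ?_⟩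
    obtain ⟨a, ha, hpa⟩ := exists_enabled_weight_ne_zero hp (hen s)
    exact ⟨a, ha, fun s' hs' => hX s hs s' (M.killedMatrix_ne_zero hp (hXG s hs) ha hpa hs')⟩
  exact hd x (hXG x hx) (Set.mem_sUnion.2 ⟨X, hXt, hx⟩)

open Classical in
/-- A policy that remains in the trap region and chooses all enabled actions with positive
probability outside of it. -/
theorem exists_trapping_policy {M : MDP S A AP} {B : Set AP → Prop}
    (hen : ∀ s, (M.enabled s).Nonempty) : ∃ p ∈ M.policies,
      (∀ s ∈ M.trapRegion B, ∀ a ∈ M.enabled s, p s a ≠ 0 →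
        ∀ s', M.P s a s' ≠ 0 → s' ∈ M.trapRegion B) ∧
      ∀ s ∉ M.trapRegion B, ∀ a ∈ M.enabled s, p s a ≠ 0 := by
  have : Nonempty A := ⟨(hen M.init).choose⟩
  choose! c hc hc' using (M.isTrapSet_trapRegion B).2
  refine ⟨fun s => if s ∈ M.trapRegion B then Pi.single (c s) 1 else fun a =>
    if a ∈ M.enabled s then (Finset.card {a | a ∈ M.enabled s} : ℝ)⁻¹ else 0,
    ⟨fun s => ?_, fun s _ a ha => ?_⟩, fun s hs a _ hpa => ?_, fun s hs a ha => ?_⟩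
  · dsimp only
    split_ifs with h
    · exact single_mem_stdSimplex ℝ (c s)
    · refine ⟨fun a => by dsimp only; split_ifs <;> positivity, ?_⟩
      rw [Finset.sum_ite, Finset.sum_const_zero, Finset.sum_const, add_zero, nsmul_eq_mul,
        mul_inv_cancel₀]
      obtain ⟨a, ha⟩ := hen s
      exact Nat.cast_ne_zero.2 (Finset.card_ne_zero_of_mem (a := a) (by simpa using ha))
  · dsimp only
    split_ifs with h
    · exact Pi.single_eq_of_ne (fun e : a = c s => ha (by rw [e]; exact hc s h)) 1
    · exact if_neg ha
  · simp only [if_pos hs] at hpa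
    by_cases e : a = c s
    · subst e
      exact hc' s hs
    · exact absurd (Pi.single_eq_of_ne e 1) hpa
  · simp only [if_neg hs, if_pos ha]
    exact inv_ne_zero (Nat.cast_ne_zero.2 (Finset.card_ne_zero_of_mem (a := a) (by simpa using ha)))

open Classical in
theorem killedReward_one {M : MDP S A AP} (G : Set S) {p : S → A → ℝ} (hp : p ∈ M.policies) :
    killedReward G p (fun _ _ => 1) = G.indicator 1 := by
  ext s
  by_cases h : s ∈ G <;> simp [killedReward, h, (hp.1 s).2]

open Classical in
/-- Reward-finiteness for one reward structure implies properness, which no longer refers to the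
reward. Let `C` be the trap region and `D` the set of states from which `C` is reached with
positive probability under a trapping policy; the set `R` is the complement of `D`. -/
theorem exists_isProper {M : MDP S A AP} {B : Set AP → Prop} {ρ : S → A → ℝ}
    (hen : ∀ s, (M.enabled s).Nonempty) (hfin : M.RewardFinite ρ B) : ∃ R, M.IsProper B R := by
  obtain ⟨p, hp, htrap, hunif⟩ := exists_trapping_policy (B := B) hen
  set C := M.trapRegion B with hC
  set L := M.liveSet B with hL
  set T := M.killedMatrix L p with hT
  have hCL : C ⊆ L := (M.isTrapSet_trapRegion B).1
  have hS : IsSubstochastic T := M.isSubstochastic_killedMatrix L hp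
  set χ : S → ℝ := C.indicator 1 with hχ
  set ψ : S → ℝ := L.indicator 1 with hψ
  have hχ0 : 0 ≤ χ := Set.indicator_nonneg fun _ _ => zero_le_one
  have hχψ : χ ≤ ψ := Set.indicator_le_indicator_of_subset hCL fun _ => zero_le_one
  -- from `C`, the chain moves to `C` only
  have hTC : ∀ s ∈ C, ∀ f g : S → ℝ, (∀ s' ∈ C, f s' = g s') → (T *ᵥ f) s = (T *ᵥ g) s := by
    intro s hs f g hfg
    rw [M.killedMatrix_mulVec_apply L p _ (hCL hs), M.killedMatrix_mulVec_apply L p _ (hCL hs)]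
    refine Finset.sum_congr rfl fun a _ => ?_
    by_cases hpa : p s a = 0
    · simp [hpa]
    have ha : a ∈ M.enabled s := by
      by_contra ha
      exact hpa (hp.2 s (hen s) a ha)
    congr 1
    refine Finset.sum_congr rfl fun s' _ => ?_
    rw [toReal_next ha]
    by_cases hP : M.P s a s' = 0
    · simp [hP]
    · rw [hfg s' (htrap s hs a ha hpa s' hP)]
  have hT1 : ∀ s ∈ L, (T *ᵥ 1) s = 1 := by
    intro s hs
    rw [M.killedMatrix_mulVec_apply L p _ hs]
    simp [sum_toReal_next, (hp.1 s).2]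
  have hχT : χ ≤ T *ᵥ χ := by
    intro s
    by_cases hs : s ∈ C
    · rw [hTC s hs χ 1 (fun s' hs' => by simp [χ, hs']), hT1 s (hCL hs)]
      simp [χ, hs]
    · simpa [χ, hs] using hS.mulVec_mono hχ0 s
  have hψT : T *ᵥ ψ ≤ ψ := by
    intro s
    by_cases hs : s ∈ L
    · have := hS.mulVec_mono (f := ψ) (g := 1)
        (Set.indicator_le_self' fun _ _ => zero_le_one) s
      rw [hT1 s hs] at this
      simpa [ψ, hs] using this
    · rw [M.killedMatrix_mulVec_apply_of_notMem L p _ hs]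
      simp [ψ, hs]
  have hmono : Monotone fun t => T ^ t *ᵥ χ := monotone_nat_of_le_succ fun t => by
    rw [pow_succ, ← mulVec_mulVec]
    exact hS.pow_mulVec_mono t hχT
  have hanti : Antitone fun t => T ^ t *ᵥ ψ := antitone_nat_of_succ_le fun t => by
    rw [pow_succ, ← mulVec_mulVec]
    exact hS.pow_mulVec_mono t hψT
  -- outside of `C` the chain is transient
  have htr : ∀ s, Summable fun t => (T ^ t *ᵥ (ψ - χ)) s := by
    have hsub : L \ C ⊆ M.liveSet B := Set.sdiff_subset
    have htr' := isTransient_of_disjoint_trapRegion hen hsub (fun s hs => hs.2) hp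
    have hS' := M.isSubstochastic_killedMatrix (L \ C) hp
    have heq : ∀ t, T ^ t *ᵥ (ψ - χ) = M.killedMatrix (L \ C) p ^ t *ᵥ (ψ - χ) ∧
        ∀ s ∈ C, (T ^ t *ᵥ (ψ - χ)) s = 0 := by
      intro t
      induction t with
      | zero =>
        refine ⟨rfl, fun s hs => ?_⟩
        simp [ψ, χ, hs, hCL hs]
      | succ t ih =>
        have h0 : ∀ s ∈ C, (T ^ (t + 1) *ᵥ (ψ - χ)) s = 0 := by
          intro s hs
          rw [pow_succ', ← mulVec_mulVec, hTC s hs _ 0 ih.2, mulVec_zero, Pi.zero_apply]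
        refine ⟨?_, h0⟩
        ext s
        by_cases hs : s ∈ C
        · rw [h0 s hs, pow_succ', ← mulVec_mulVec,
            M.killedMatrix_mulVec_apply_of_notMem _ _ _ fun h => h.2 hs]
        · rw [pow_succ', pow_succ', ← mulVec_mulVec, ← mulVec_mulVec, ← ih.1]
          by_cases hl : s ∈ L
          · rw [M.killedMatrix_mulVec_apply _ _ _ hl,
              M.killedMatrix_mulVec_apply _ _ _ (show s ∈ L \ C from ⟨hl, hs⟩)]
          · rw [M.killedMatrix_mulVec_apply_of_notMem _ _ _ hl,
              M.killedMatrix_mulVec_apply_of_notMem _ _ _ fun h => hl h.1]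
    intro s
    exact (htr'.summable hS' (ψ - χ) s).congr fun t => by rw [(heq t).1]
  -- The states from which `C` is reached with positive probability.
  set D : Set S := {s | ∃ k, 0 < (T ^ k *ᵥ χ) s} with hD
  have hCD : ∀ s ∈ C, s ∈ D := fun s hs => ⟨0, by simp [χ, hs]⟩
  refine ⟨Dᶜ, ?_, ?_, ?_⟩
  · rintro ⟨k, hk⟩
    obtain ⟨μ, hμ⟩ := exists_weight_eq hp
    have hkv : ∀ t, M.killedValue (M.liveSet B) μ.weight (fun _ _ => 1) t =
        (T ^ t *ᵥ ψ) M.init := by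
      intro t
      rw [killedValue, hμ, killedReward_one _ hp]
    have htop := expReward_eq_top μ B ρ hk (c := fun t => (T ^ t *ᵥ (ψ - χ)) M.init)
      (fun t => ?_) (htr _) (fun t N htN => ?_)
    · have hlt := (le_iSup (fun μ => M.expReward ρ B μ) μ).trans_lt hfin
      rw [htop] at hlt
      exact lt_irrefl _ hlt
    · rw [hkv]
      rcases le_total k t with h | h
      · exact (hmono h _).trans (hS.pow_mulVec_mono t hχψ _)
      · exact (hS.pow_mulVec_mono k hχψ _).trans (hanti h _)
    · rw [hkv, hkv, mulVec_sub, Pi.sub_apply]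
      have h1 : (T ^ t *ᵥ χ) M.init ≤ (T ^ N *ᵥ ψ) M.init :=
        (hmono htN _).trans (hS.pow_mulVec_mono N hχψ _)
      linarith
  · intro s hs hsB a ha s' hP hs'
    obtain ⟨k, hk⟩ := hs'
    refine hs ⟨k + 1, ?_⟩
    have hsC : s ∉ C := fun h => hs (hCD s h)
    have hne := M.killedMatrix_ne_zero (G := L) hp hsB ha (hunif s hsC a ha) hP
    rw [pow_succ', ← mulVec_mulVec]
    have h0 : ∀ j, 0 ≤ (T ^ k *ᵥ χ) j := fun j => by
      simpa using hS.pow_mulVec_mono k hχ0 j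
    exact Finset.sum_pos' (fun j _ => mul_nonneg (hS.nonneg s j) (h0 j))
      ⟨s', Finset.mem_univ _, mul_pos ((hS.nonneg s s').lt_of_ne' hne) hk⟩
  · intro q hq
    exact isTransient_of_disjoint_trapRegion hen Set.inter_subset_right
      (fun s hs hsC => Set.notMem_of_mem_compl hs.1 (hCD s hsC)) hq

end MDP
end MORAP

namespace MORAP
open MDP

/-! ### The transitions of the centralised MDP -/

instance : Fintype CtMove :=
  ⟨⟨([.b₁, .b₂, .b₃] : List CtMove), by simp⟩, by rintro (_ | _ | _) <;> simp⟩

theorem sum_ctMove (g : CtMove → ℝ) : ∑ b, g b = g .b₁ + g .b₂ + g .b₃ := by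
  simp [Finset.sum, Finset.univ, Fintype.elems, add_assoc]

section
variable {n : ℕ} {AP A : Type*} {S Q : Fin n → Type*} [∀ i, Fintype (S i)] [∀ j, Fintype (Q j)]

theorem enabled_agentTask {AP A S Q : Type*} [Fintype S] [Fintype Q] (M : MDP S A AP)
    (D : DFA (Set AP) Q) (x : S × Q) : (agentTask M D).enabled x = M.enabled x.1 := by
  classical
  ext a
  have h : ∑ y, (agentTask M D).P x a y = ∑ s', M.P x.1 a s' := by
    simp only [agentTask, product]
    rw [Fintype.sum_prod_type]
    simp
  simp [enabled, h]

theorem mem_liveSet_agentTask {AP A S Q : Type*} [Fintype S] [Fintype Q] {M : MDP S A AP}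
    {D : DFA (Set AP) Q} {x : S × Q} :
    x ∈ (agentTask M D).liveSet (fun W => none ∈ W) ↔ ¬ Ended D x.2 := by
  simp [liveSet, agentTask]

variable {M : ∀ i, MDP (S i) A AP} {D : ∀ j, DFA (Set AP) (Q j)}

theorem sum_ctP_inl_mul {i j : Fin n} {s : S i} {q : Q j} {T : Finset (Fin n)} (a : A)
    (h : i ∈ T ∧ ¬ Ended (D j) q) (f : CtState S Q → ℝ) :
    ∑ y, (ctP M D (⟨i, s⟩, ⟨j, q⟩, T) (.inl a) y : ℝ) * f y =
      ∑ x, ((agentTask (M i) (D j)).P (s, q) a x : ℝ) * f (⟨i, x.1⟩, ⟨j, x.2⟩, T) := by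
  classical
  simp only [ctP, if_pos h, NNReal.coe_sum, Finset.sum_mul]
  rw [Finset.sum_comm]
  refine Finset.sum_congr rfl fun x _ => ?_
  rw [Finset.sum_eq_single (⟨i, x.1⟩, ⟨j, x.2⟩, T)]
  · simp
  · intro y _ hy
    simp [hy]
  · simp

variable [NeZero n]

theorem inl_mem_enabled_centralised {i j : Fin n} {s : S i} {q : Q j} {T : Finset (Fin n)} {a : A} :
    .inl a ∈ (centralised M D).enabled (⟨i, s⟩, ⟨j, q⟩, T) ↔
      (i ∈ T ∧ ¬ Ended (D j) q) ∧ a ∈ (M i).enabled s := by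
  change ∑ y, ctP M D (⟨i, s⟩, ⟨j, q⟩, T) (.inl a) y = 1 ↔ _
  by_cases h : i ∈ T ∧ ¬ Ended (D j) q
  · have h1 := sum_ctP_inl_mul (M := M) (s := s) a h fun _ => 1
    simp only [mul_one] at h1
    have h2 := enabled_agentTask (M i) (D j) (s, q)
    rw [← NNReal.coe_inj, NNReal.coe_sum, h1, ← NNReal.coe_sum, NNReal.coe_inj]
    simp only [h, true_and, not_false_eq_true]
    rw [show a ∈ (M i).enabled s ↔ a ∈ (agentTask (M i) (D j)).enabled (s, q) by rw [h2]]
    rfl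
  · simp [ctP, h]

theorem inr_mem_enabled_centralised {x : CtState S Q} {b : CtMove} :
    .inr b ∈ (centralised M D).enabled x ↔ ∃ y, ctMove M D b x y := by
  classical
  change ∑ y, ctP M D x (.inr b) y = 1 ↔ _
  constructor
  · intro h
    by_contra! h'
    simp [ctP, h'] at h
  · rintro ⟨y, hy⟩
    have e : ∀ z, ctMove M D b x z ↔ z = y :=
      fun z => ⟨fun hz => ctMove_unique M D hz hy, fun hz => hz ▸ hy⟩
    simp [ctP, e]

theorem sum_next_inl_mul {i j : Fin n} {s : S i} {q : Q j} {T : Finset (Fin n)} {a : A}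
    (h : i ∈ T ∧ ¬ Ended (D j) q) (ha : a ∈ (M i).enabled s) (f : CtState S Q → ℝ) :
    ∑ y, ((centralised M D).next (⟨i, s⟩, ⟨j, q⟩, T) (.inl a) y).toReal * f y =
      ∑ x, ((agentTask (M i) (D j)).next (s, q) a x).toReal * f (⟨i, x.1⟩, ⟨j, x.2⟩, T) := by
  simp_rw [toReal_next (inl_mem_enabled_centralised.2 ⟨h, ha⟩)]
  simp_rw [toReal_next (show a ∈ (agentTask (M i) (D j)).enabled (s, q) by
    rw [enabled_agentTask]; exact ha)]
  exact sum_ctP_inl_mul a h f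

theorem sum_next_inr_mul {x y : CtState S Q} {b : CtMove} (h : ctMove M D b x y)
    (f : CtState S Q → ℝ) :
    ∑ z, ((centralised M D).next x (.inr b) z).toReal * f z = f y := by
  classical
  simp_rw [toReal_next (inr_mem_enabled_centralised.2 ⟨y, h⟩)]
  have e : ∀ z, ctMove M D b x z ↔ z = y :=
    fun z => ⟨fun hz => ctMove_unique M D hz h, fun hz => hz ▸ h⟩
  have hP : ∀ z, ((centralised M D).P x (.inr b) z : ℝ) = if z = y then 1 else 0 := fun z => by
    by_cases hz : z = y <;> simp [centralised, ctP, e, hz]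
  simp [hP]

/-- The states of the centralised MDP that matter: either task `j` (counted from `0`) is about
to be taken by or passed on from a free agent, and `j` agents are used up, or agent `i` has
taken task `j`, `j + 1` agents are used up, and the agent-task state is in `R i j`. -/
def ctRegion (M : ∀ i, MDP (S i) A AP) (D : ∀ j, DFA (Set AP) (Q j))
    (R : ∀ i j, Set (S i × Q j)) : Set (CtState S Q) :=
  {x | (x.1.1 ∉ x.2.2 ∧ x.2.2.card = x.2.1.1 ∧ x.1.2 = (M x.1.1).init ∧
      x.2.1.2 = (D x.2.1.1).start) ∨
    (x.1.1 ∈ x.2.2 ∧ x.2.2.card = x.2.1.1 + 1 ∧ (x.1.2, x.2.1.2) ∈ R x.1.1 x.2.1.1)}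

theorem mem_liveSet_centralised {i j : Fin n} {s : S i} {q : Q j} {T : Finset (Fin n)} :
    ((⟨i, s⟩, ⟨j, q⟩, T) : CtState S Q) ∈ (centralised M D).liveSet (fun W => () ∈ W) ↔
      ¬ ((j : ℕ) + 1 = n ∧ Ended (D j) q) := by
  simp [liveSet, centralised]

/-- The states in `R i j` at which the task is not ended. -/
abbrev atLive (M : ∀ i, MDP (S i) A AP) (D : ∀ j, DFA (Set AP) (Q j))
    (R : ∀ i j, Set (S i × Q j)) (i j : Fin n) : Set (S i × Q j) :=
  R i j ∩ (agentTask (M i) (D j)).liveSet (fun W => none ∈ W)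

/-- The states in `ctRegion` at which the last task is not ended. -/
abbrev ctLive (M : ∀ i, MDP (S i) A AP) (D : ∀ j, DFA (Set AP) (Q j))
    (R : ∀ i j, Set (S i × Q j)) : Set (CtState S Q) :=
  ctRegion M D R ∩ (centralised M D).liveSet (fun W => () ∈ W)

theorem inr_notMem_enabled {i j : Fin n} {s : S i} {q : Q j} {T : Finset (Fin n)}
    (h : i ∈ T ∧ ¬ Ended (D j) q) (b : CtMove) :
    .inr b ∉ (centralised M D).enabled (⟨i, s⟩, ⟨j, q⟩, T) := by
  rw [inr_mem_enabled_centralised]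
  rintro ⟨y, hy⟩
  cases b with
  | b₁ => exact hy.2.2.1 h.1
  | b₂ => exact hy.2.2.1 h.1
  | b₃ => exact h.2 hy.1

variable [Fintype A]

open Classical in
/-- Restriction of a policy of the centralised MDP to the phase in which agent `i` works on task
`j` and the used-up agents are `T`. Where the task is ended, the enabled actions `c` serve as a
filler. -/
noncomputable def localPolicy (D : ∀ j, DFA (Set AP) (Q j)) (c : ∀ i, S i → A)
    (p : CtState S Q → A ⊕ CtMove → ℝ) (i j : Fin n)
    (T : Finset (Fin n)) (x : S i × Q j) : A → ℝ :=
  if i ∈ T ∧ ¬ Ended (D j) x.2 then fun a => p (⟨i, x.1⟩, ⟨j, x.2⟩, T) (.inl a)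
  else Pi.single (c i x.1) 1

theorem policy_inr_eq_zero (hM : ∀ i s, ((M i).enabled s).Nonempty)
    {p : CtState S Q → A ⊕ CtMove → ℝ} (hp : p ∈ (centralised M D).policies)
    {i j : Fin n} {s : S i} {q : Q j} {T : Finset (Fin n)}
    (h : i ∈ T ∧ ¬ Ended (D j) q) (b : CtMove) : p (⟨i, s⟩, ⟨j, q⟩, T) (.inr b) = 0 := by
  obtain ⟨a, ha⟩ := hM i s
  exact hp.2 _ ⟨.inl a, inl_mem_enabled_centralised.2 ⟨h, ha⟩⟩ _ (inr_notMem_enabled h b)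

theorem localPolicy_mem (hM : ∀ i s, ((M i).enabled s).Nonempty) {c : ∀ i, S i → A}
    (hc : ∀ i s, c i s ∈ (M i).enabled s)
    {p : CtState S Q → A ⊕ CtMove → ℝ} (hp : p ∈ (centralised M D).policies) (i j : Fin n)
    (T : Finset (Fin n)) : localPolicy D c p i j T ∈ (agentTask (M i) (D j)).policies := by
  classical
  refine ⟨fun x => ?_, fun x _ a ha => ?_⟩
  · unfold localPolicy
    split_ifs with h
    · refine ⟨fun a => (hp.1 _).1 _, ?_⟩
      have := (hp.1 (⟨i, x.1⟩, ⟨j, x.2⟩, T)).2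
      rw [Fintype.sum_sum_type] at this
      simpa [policy_inr_eq_zero hM hp h] using this
    · exact single_mem_stdSimplex ℝ _
  · rw [enabled_agentTask] at ha
    unfold localPolicy
    split_ifs with h
    · obtain ⟨a', ha'⟩ := hM i x.1
      exact hp.2 _ ⟨.inl a', inl_mem_enabled_centralised.2 ⟨h, ha'⟩⟩ _
        fun h' => ha (inl_mem_enabled_centralised.1 h').2
    · exact Pi.single_eq_of_ne (fun e : a = c i x.1 => ha (e ▸ hc i x.1)) 1

/-! ### The value equations of the centralised MDP -/

section Value

variable (hM : ∀ i s, ((M i).enabled s).Nonempty) {c : ∀ i, S i → A}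
    (hc : ∀ i s, c i s ∈ (M i).enabled s)
    {R : ∀ i j, Set (S i × Q j)}
    (hR : ∀ i j, (agentTask (M i) (D j)).IsProper (fun W => none ∈ W) (R i j))
    {p : CtState S Q → A ⊕ CtMove → ℝ} (hp : p ∈ (centralised M D).policies)
    {ρct : CtState S Q → A ⊕ CtMove → ℝ} {ρat : ∀ i j, S i × Q j → A → ℝ}
    (hρ : RestrictsTo M ρct ρat) {V : CtState S Q → ℝ}
    (hV : (centralised M D).IsValue (ctLive M D R) p ρct V)

include hM hc hR hp hρ hV in
/-- While agent `i` works on task `j`, the value is the value of the restricted policy on the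
agent-task MDP plus the value `U` at the end of the task, which does not depend on the state in
which it ends. -/
theorem value_working {i j : Fin n} {T : Finset (Fin n)} (hiT : i ∈ T) (hT : T.card = j + 1) {U : ℝ}
    (hU : ∀ s q, (s, q) ∈ R i j → Ended (D j) q → V (⟨i, s⟩, ⟨j, q⟩, T) = U)
    {s : S i} {q : Q j} (hsq : (s, q) ∈ R i j) :
    V (⟨i, s⟩, ⟨j, q⟩, T) = (agentTask (M i) (D j)).policyValue (atLive M D R i j)
      (localPolicy D c p i j T) (ρat i j) (s, q) + U := by
  classical
  have hloc := localPolicy_mem hM hc hp i j T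
  set f : S i × Q j → ℝ := fun x =>
    if x ∈ atLive M D R i j then V (⟨i, x.1⟩, ⟨j, x.2⟩, T) - U else 0 with hf
  have hfR : ∀ x ∈ R i j, V (⟨i, x.1⟩, ⟨j, x.2⟩, T) = f x + U := by
    intro x hx
    by_cases hl : x ∈ atLive M D R i j
    · simp only [f, if_pos hl, sub_add_cancel]
    · have : Ended (D j) x.2 := by
        by_contra hne
        exact hl ⟨hx, mem_liveSet_agentTask.2 hne⟩
      simp only [f, if_neg hl, zero_add, hU x.1 x.2 hx this]
  suffices hval : (agentTask (M i) (D j)).IsValue (atLive M D R i j)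
      (localPolicy D c p i j T) (ρat i j) f by
    rw [← (hR i j).eq_policyValue hloc hval]
    exact hfR _ hsq
  refine ⟨fun x hx => ?_, fun x hx => if_neg hx⟩
  have hne : ¬ Ended (D j) x.2 := mem_liveSet_agentTask.1 hx.2
  have hct : ((⟨i, x.1⟩, ⟨j, x.2⟩, T) : CtState S Q) ∈ ctLive M D R :=
    ⟨Or.inr ⟨hiT, hT, hx.1⟩, mem_liveSet_centralised.2 fun h => hne h.2⟩
  have hb := hV.eq_sum _ hct
  rw [Fintype.sum_sum_type] at hb
  simp only [policy_inr_eq_zero hM hp ⟨hiT, hne⟩, zero_mul, Finset.sum_const_zero, add_zero] at hb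
  have hfx : f x = V (⟨i, x.1⟩, ⟨j, x.2⟩, T) - U := if_pos hx
  rw [hfx, hb]
  have h1 : ∀ a, p (⟨i, x.1⟩, ⟨j, x.2⟩, T) (.inl a) = localPolicy D c p i j T x a := by
    intro a
    simp [localPolicy, hiT, hne]
  simp_rw [h1]
  have h2 : U = ∑ a, localPolicy D c p i j T x a * U := by
    rw [← Finset.sum_mul, (hloc.1 x).2, one_mul]
  conv_lhs => rw [h2]
  rw [← Finset.sum_sub_distrib]
  refine Finset.sum_congr rfl fun a _ => ?_
  by_cases ha : a ∈ (M i).enabled x.1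
  · rw [← mul_sub, hρ.1 i j _ _ _ _ ha, sum_next_inl_mul ⟨hiT, hne⟩ ha]
    have h3 : ∑ y, ((agentTask (M i) (D j)).next x a y).toReal * V (⟨i, y.1⟩, ⟨j, y.2⟩, T) =
        ∑ y, ((agentTask (M i) (D j)).next x a y).toReal * f y + U := by
      have h4 : ∀ y, ((agentTask (M i) (D j)).next x a y).toReal * V (⟨i, y.1⟩, ⟨j, y.2⟩, T) =
          ((agentTask (M i) (D j)).next x a y).toReal * f y +
          ((agentTask (M i) (D j)).next x a y).toReal * U := by
        intro y
        have ha' : a ∈ (agentTask (M i) (D j)).enabled x := by rwa [enabled_agentTask]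
        rw [toReal_next ha']
        by_cases h0 : (agentTask (M i) (D j)).P x a y = 0
        · simp [h0]
        · rw [hfR y ((hR i j).closed x hx.1 hx.2 a ha' y h0), mul_add]
      simp_rw [h4]
      rw [Finset.sum_add_distrib, ← Finset.sum_mul, sum_toReal_next, one_mul]
    rw [h3]
    ring
  · have : localPolicy D c p i j T x a = 0 :=
      hloc.2 x (by rw [enabled_agentTask]; exact hM i _) a (by rwa [enabled_agentTask])
    rw [this]
    simp

include hp hρ hV in
theorem value_next_task {i i' j j' : Fin n} {s : S i} {q : Q j} {T : Finset (Fin n)}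
    (hiT : i ∈ T) (hT : T.card = j + 1) (hsq : (s, q) ∈ R i j) (hq : Ended (D j) q)
    (hi' : IsLeast {i'' | i'' ∉ T} i') (hj' : (j' : ℕ) = j + 1) :
    V (⟨i, s⟩, ⟨j, q⟩, T) = V (⟨i', (M i').init⟩, ⟨j', (D j').start⟩, T) := by
  have hmove : ctMove M D .b₃ (⟨i, s⟩, ⟨j, q⟩, T) (⟨i', (M i').init⟩, ⟨j', (D j').start⟩, T) :=
    ⟨hq, hiT, i', j', hi', hj', rfl⟩
  rw [hV.eq_sum _ ⟨Or.inr ⟨hiT, hT, hsq⟩, mem_liveSet_centralised.2 fun h => by omega⟩,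
    sum_policy_eq_single hp (inr_mem_enabled_centralised.2 ⟨_, hmove⟩), hρ.2, zero_add,
    sum_next_inr_mul hmove]
  rintro (a | b) hb
  · exact absurd hq (inl_mem_enabled_centralised.1 hb).1.2
  · obtain ⟨y, hy⟩ := inr_mem_enabled_centralised.1 hb
    cases b with
    | b₁ => exact absurd hiT hy.2.2.1
    | b₂ => exact absurd hiT hy.2.2.1
    | b₃ => rfl

include hp hρ hV in
/-- The value at a state of choice is a convex combination of the values after taking the task
(`b₁`) and after forwarding it (`b₂`). If there is no agent to forward to, the second weight is
zero and `z` is arbitrary. -/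
theorem value_choice {i j : Fin n} {T : Finset (Fin n)} (hiT : i ∉ T) (hT : T.card = j)
    (hlive : ¬ ((j : ℕ) + 1 = n ∧ Ended (D j) (D j).start)) {z : ℝ}
    (hz : ∀ i', IsLeast {i'' | i < i'' ∧ i'' ∉ T} i' →
      z = V (⟨i', (M i').init⟩, ⟨j, (D j).start⟩, T)) :
    p (⟨i, (M i).init⟩, ⟨j, (D j).start⟩, T) (.inr .b₁) +
        p (⟨i, (M i).init⟩, ⟨j, (D j).start⟩, T) (.inr .b₂) = 1 ∧
    V (⟨i, (M i).init⟩, ⟨j, (D j).start⟩, T) =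
      p (⟨i, (M i).init⟩, ⟨j, (D j).start⟩, T) (.inr .b₁) *
        V (⟨i, (M i).init⟩, ⟨j, (D j).start⟩, insert i T) +
      p (⟨i, (M i).init⟩, ⟨j, (D j).start⟩, T) (.inr .b₂) * z := by
  set x : CtState S Q := (⟨i, (M i).init⟩, ⟨j, (D j).start⟩, T) with hx
  have hmove : ctMove M D .b₁ x (⟨i, (M i).init⟩, ⟨j, (D j).start⟩, insert i T) :=
    ⟨rfl, rfl, hiT, rfl⟩
  have hne : ((centralised M D).enabled x).Nonempty :=
    ⟨_, inr_mem_enabled_centralised.2 ⟨_, hmove⟩⟩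
  have hinl : ∀ a, p x (.inl a) = 0 := fun a =>
    hp.2 x hne _ fun h => hiT (inl_mem_enabled_centralised.1 h).1.1
  have hb₃ : p x (.inr .b₃) = 0 := by
    refine hp.2 x hne _ fun h => ?_
    obtain ⟨y, hy⟩ := inr_mem_enabled_centralised.1 h
    exact hiT hy.2.1
  have hsum := (hp.1 x).2
  rw [Fintype.sum_sum_type, sum_ctMove] at hsum
  simp only [hinl, hb₃, Finset.sum_const_zero, zero_add, add_zero] at hsum
  refine ⟨hsum, ?_⟩
  rw [hV.eq_sum x ⟨Or.inl ⟨hiT, hT, rfl, rfl⟩, mem_liveSet_centralised.2 hlive⟩,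
    Fintype.sum_sum_type, sum_ctMove]
  simp only [hinl, hb₃, Finset.sum_const_zero, zero_add, add_zero, zero_mul, hρ.2]
  rw [sum_next_inr_mul hmove]
  congr 1
  by_cases h : .inr .b₂ ∈ (centralised M D).enabled x
  · obtain ⟨y, hy⟩ := inr_mem_enabled_centralised.1 h
    rw [sum_next_inr_mul hy]
    obtain ⟨-, -, -, i', hi', rfl⟩ := hy
    rw [hz i' hi']
  · rw [hp.2 x hne _ h, zero_mul, zero_mul]

end Value
end
end MORAP

namespace MORAP
open MDP

/-! ### Partial assignments of agents to tasks -/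

section Assignment
variable {n : ℕ}

/-- A matrix that distributes the agents outside of `T` among the tasks `t, …, n - 1` (counted
from `0`), like a doubly stochastic matrix. For `T = ∅` and `t = 0` it is doubly stochastic. -/
structure IsPartialAssignment (T : Finset (Fin n)) (t : ℕ) (x : Matrix (Fin n) (Fin n) ℝ) :
    Prop where
  nonneg : ∀ i j, 0 ≤ x i j
  sum_row : ∀ i, ∑ j, x i j = if i ∈ T then 0 else 1
  sum_col : ∀ j : Fin n, ∑ i, x i j = if (j : ℕ) < t then 0 else 1

/-- The number `z` lies between the sums of the lower bounds `m` and of the upper bounds `m'`,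
weighted by some partial assignment. -/
def IsBracketed (m m' : Fin n → Fin n → ℝ) (T : Finset (Fin n)) (t : ℕ) (z : ℝ) : Prop :=
  ∃ x, IsPartialAssignment T t x ∧ ∑ i, ∑ j, x i j * m i j ≤ z ∧ z ≤ ∑ i, ∑ j, x i j * m' i j

variable {m m' : Fin n → Fin n → ℝ} {T : Finset (Fin n)} {t : ℕ}

theorem IsBracketed.convex {z z' a b : ℝ} (h : IsBracketed m m' T t z)
    (h' : IsBracketed m m' T t z') (ha : 0 ≤ a) (hb : 0 ≤ b) (hab : a + b = 1) :
    IsBracketed m m' T t (a * z + b * z') := by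
  obtain ⟨x, hx, h1, h2⟩ := h
  obtain ⟨y, hy, h3, h4⟩ := h'
  have hs : ∀ g : Fin n → Fin n → ℝ, ∑ i, ∑ j, (a * x i j + b * y i j) * g i j =
      a * ∑ i, ∑ j, x i j * g i j + b * ∑ i, ∑ j, y i j * g i j := by
    intro g
    simp only [Finset.mul_sum, ← Finset.sum_add_distrib]
    refine Finset.sum_congr rfl fun i _ => Finset.sum_congr rfl fun j _ => by ring
  refine ⟨fun i j => a * x i j + b * y i j, ⟨fun i j => ?_, fun i => ?_, fun j => ?_⟩, ?_, ?_⟩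
  · have := hx.nonneg i j
    have := hy.nonneg i j
    positivity
  · rw [Finset.sum_add_distrib, ← Finset.mul_sum, ← Finset.mul_sum, hx.sum_row, hy.sum_row,
      ← add_mul, hab, one_mul]
  · rw [Finset.sum_add_distrib, ← Finset.mul_sum, ← Finset.mul_sum, hx.sum_col, hy.sum_col,
      ← add_mul, hab, one_mul]
  · rw [hs]
    gcongr
  · rw [hs]
    gcongr

theorem IsBracketed.add_assignment {U v : ℝ} {i j : Fin n} (hi : i ∉ T)
    (h : IsBracketed m m' (insert i T) (j + 1) U) (hv : v ∈ Set.Icc (m i j) (m' i j)) :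
    IsBracketed m m' T j (v + U) := by
  obtain ⟨x, hx, h1, h2⟩ := h
  have hs : ∀ g : Fin n → Fin n → ℝ,
      ∑ i', ∑ j', (x i' j' + if i' = i then if j' = j then 1 else 0 else 0) * g i' j' =
        g i j + ∑ i', ∑ j', x i' j' * g i' j' := by
    intro g
    simp only [add_mul, Finset.sum_add_distrib, ite_mul, one_mul, zero_mul]
    rw [add_comm]
    congr 1
    rw [Finset.sum_eq_single i (fun i' _ hi' => by simp [hi']) (by simp)]
    simp
  refine ⟨fun i' j' => x i' j' + if i' = i then if j' = j then 1 else 0 else 0,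
    ⟨fun i' j' => add_nonneg (hx.nonneg _ _) (by split_ifs <;> simp), fun i' => ?_, fun j' => ?_⟩,
    ?_, ?_⟩
  · rw [Finset.sum_add_distrib, hx.sum_row]
    by_cases e : i' = i
    · subst e
      simp [hi]
    · simp [e]
  · rw [Finset.sum_add_distrib, hx.sum_col]
    have e : ∑ i', (if i' = i then if j' = j then (1 : ℝ) else 0 else 0) =
        if j' = j then 1 else 0 := by simp
    rw [e]
    rcases lt_trichotomy (j' : ℕ) j with h | h | h
    · rw [if_pos (by omega), if_neg (fun e => by subst e; omega), if_pos h, add_zero]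
    · obtain rfl := Fin.ext h
      simp
    · rw [if_neg (by omega), if_neg (fun e => by subst e; omega), if_neg (by omega), add_zero]
  · rw [hs]
    exact add_le_add hv.1 h1
  · rw [hs]
    exact add_le_add hv.2 h2

theorem isBracketed_univ : IsBracketed m m' (Finset.univ : Finset (Fin n)) n 0 :=
  ⟨0, ⟨fun _ _ => le_rfl, fun i => by simp, fun j => by simp⟩, by simp, by simp⟩

theorem exists_isLeast_notMem {T : Finset (Fin n)} (hT : T.card < n) :
    ∃ i, IsLeast {i' | i' ∉ T} i := by
  have hne : {i' | i' ∉ T}.Nonempty := by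
    by_contra h
    have : T = Finset.univ := by
      ext i
      by_contra h'
      exact h ⟨i, by simpa using h'⟩
    simp [this] at hT
  exact ⟨_, WellFounded.min_mem wellFounded_lt _ hne,
    fun i hi => not_lt.1 (WellFounded.not_lt_min wellFounded_lt _ hi)⟩

theorem exists_isLeast_gt_notMem {T : Finset (Fin n)} {i i₀ : Fin n} (hi : i < i₀) (h₀ : i₀ ∉ T) :
    ∃ i', IsLeast {i'' | i < i'' ∧ i'' ∉ T} i' := by
  have hne : {i'' | i < i'' ∧ i'' ∉ T}.Nonempty := ⟨i₀, hi, h₀⟩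
  exact ⟨_, WellFounded.min_mem wellFounded_lt _ hne,
    fun i hi => not_lt.1 (WellFounded.not_lt_min wellFounded_lt _ hi)⟩

end Assignment

/-! ### Central values and doubly stochastic matrices -/

section Central

variable {n : ℕ} [NeZero n] {AP A : Type*} [Fintype A] {S Q : Fin n → Type*}
  [∀ i, Fintype (S i)] [∀ j, Fintype (Q j)]
  {M : ∀ i, MDP (S i) A AP} {D : ∀ j, DFA (Set AP) (Q j)}
  {R : ∀ i j, Set (S i × Q j)}

/-- The value is zero where the last task is ended. -/
theorem value_eq_zero {p ρct : CtState S Q → A ⊕ CtMove → ℝ} {V : CtState S Q → ℝ}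
    (hV : (centralised M D).IsValue (ctLive M D R) p ρct V) {i j : Fin n} {s : S i} {q : Q j}
    {T : Finset (Fin n)} (hj : (j : ℕ) + 1 = n) (hq : Ended (D j) q) :
    V (⟨i, s⟩, ⟨j, q⟩, T) = 0 :=
  hV.eq_zero _ fun h => mem_liveSet_centralised.1 h.2 ⟨hj, hq⟩

/-- Backward induction over the number `t` of completed tasks, and over the agents in decreasing
order for each task. The first part concerns the states at which the preceding task is ended,
the second part the states of choice for task `t`. -/
theorem value_isBracketed (hM : ∀ i s, ((M i).enabled s).Nonempty)
    (hR : ∀ i j, (agentTask (M i) (D j)).IsProper (fun W => none ∈ W) (R i j))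
    {p : CtState S Q → A ⊕ CtMove → ℝ} (hp : p ∈ (centralised M D).policies)
    {ρct : CtState S Q → A ⊕ CtMove → ℝ} {ρat : ∀ i j, S i × Q j → A → ℝ}
    (hρ : RestrictsTo M ρct ρat) {V : CtState S Q → ℝ}
    (hV : (centralised M D).IsValue (ctLive M D R) p ρct V)
    {m m' : Fin n → Fin n → ℝ}
    (hm : ∀ i j, ∀ p' ∈ (agentTask (M i) (D j)).policies,
      (agentTask (M i) (D j)).policyValue (atLive M D R i j) p' (ρat i j)
        ((M i).init, (D j).start) ∈ Set.Icc (m i j) (m' i j))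
    {t : ℕ} (ht : t ≤ n) :
    (∀ T : Finset (Fin n), T.card = t → ∃ U, IsBracketed m m' T t U ∧
      ∀ (i j : Fin n) (s : S i) (q : Q j), i ∈ T → (j : ℕ) + 1 = t → (s, q) ∈ R i j →
        Ended (D j) q → V (⟨i, s⟩, ⟨j, q⟩, T) = U) ∧
    ∀ (T : Finset (Fin n)) (i j : Fin n), T.card = t → i ∉ T → (j : ℕ) = t →
      IsBracketed m m' T t (V (⟨i, (M i).init⟩, ⟨j, (D j).start⟩, T)) := by
  choose c hc using hM
  induction ht using Nat.decreasingInduction with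
  | self =>
    refine ⟨fun T hT => ⟨0, ?_, fun i j s q _ hj _ hq => value_eq_zero hV hj hq⟩,
      fun T i j _ _ hj => absurd j.2 (by omega)⟩
    rw [(Finset.card_eq_iff_eq_univ T).1 (by simpa using hT)]
    exact isBracketed_univ
  | of_succ t ht ih =>
    have hchoice : ∀ (T : Finset (Fin n)) (i j : Fin n), T.card = t → i ∉ T → (j : ℕ) = t →
        IsBracketed m m' T t (V (⟨i, (M i).init⟩, ⟨j, (D j).start⟩, T)) := by
      intro T i j hT hi hj
      subst hj
      induction i using WellFoundedGT.induction with
      | ind i IH =>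
        have hcard : (insert i T).card = j + 1 := by rw [Finset.card_insert_of_notMem hi, hT]
        obtain ⟨U, hUb, hU⟩ := ih.1 (insert i T) hcard
        have hassign : IsBracketed m m' T j
            (V (⟨i, (M i).init⟩, ⟨j, (D j).start⟩, insert i T)) := by
          rw [value_working (fun i s => ⟨c i s, hc i s⟩) hc hR hp hρ hV
            (Finset.mem_insert_self i T) hcard
            (fun s q hsq hq => hU i j s q (Finset.mem_insert_self i T) rfl hsq hq)
            (hR i j).init_mem]
          exact hUb.add_assignment hi
            (hm i j _ (localPolicy_mem (fun i s => ⟨c i s, hc i s⟩) hc hp i j _))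
        -- If the last task is ended from the start, the run stops before the task is
        -- taken, and both values are zero.
        by_cases hlive : (j : ℕ) + 1 = n ∧ Ended (D j) (D j).start
        · rw [value_eq_zero hV hlive.1 hlive.2] at hassign ⊢
          exact hassign
        by_cases hnext : ∃ i', IsLeast {i'' | i < i'' ∧ i'' ∉ T} i'
        · obtain ⟨i', hi'⟩ := hnext
          obtain ⟨hsum, heq⟩ := value_choice hp hρ hV hi hT hlive
            (z := V (⟨i', (M i').init⟩, ⟨j, (D j).start⟩, T))
            (fun i'' hi'' => by rw [hi'.unique hi''])
          rw [heq]
          exact hassign.convex (IH i' hi'.1.1 hi'.1.2) ((hp.1 _).1 _) ((hp.1 _).1 _) hsum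
        · obtain ⟨hsum, heq⟩ := value_choice hp hρ hV hi hT hlive
            (z := V (⟨i, (M i).init⟩, ⟨j, (D j).start⟩, insert i T))
            (fun i'' hi'' => absurd ⟨i'', hi''⟩ hnext)
          rw [heq]
          exact hassign.convex hassign ((hp.1 _).1 _) ((hp.1 _).1 _) hsum
    refine ⟨fun T hT => ?_, hchoice⟩
    obtain ⟨i', hi'⟩ := exists_isLeast_notMem (T := T) (by omega)
    exact ⟨_, hchoice T i' ⟨t, ht⟩ hT hi'.1 rfl, fun i j s q hi hj hsq hq =>
      value_next_task hp hρ hV hi (by omega) hsq hq hi' (by simp [hj])⟩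

/-- Transience is `value_isBracketed` for zero rewards, with all bounds equal to zero. -/
theorem isProper_centralised (hM : ∀ i s, ((M i).enabled s).Nonempty)
    (hR : ∀ i j, (agentTask (M i) (D j)).IsProper (fun W => none ∈ W) (R i j)) :
    (centralised M D).IsProper (fun W => () ∈ W) (ctRegion M D R) where
  init_mem := Or.inl ⟨by simp [centralised], by simp [centralised], rfl, rfl⟩
  closed := by
    classical
    rintro ⟨⟨i, s⟩, ⟨j, q⟩, T⟩ hx hlive (a | b) ha y hy
    · obtain ⟨h, ha⟩ := inl_mem_enabled_centralised.1 ha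
      change ctP M D (⟨i, s⟩, ⟨j, q⟩, T) (.inl a) y ≠ 0 at hy
      simp only [ctP, if_pos h] at hy
      obtain ⟨z, -, hz⟩ := Finset.exists_ne_zero_of_sum_ne_zero hy
      rw [ite_ne_right_iff] at hz
      obtain ⟨rfl, hz'⟩ := hz
      rcases hx with hx | hx
      · exact absurd h.1 hx.1
      · exact Or.inr ⟨h.1, hx.2.1, (hR i j).closed _ hx.2.2 (mem_liveSet_agentTask.2 h.2) a
          (by rwa [enabled_agentTask]) _ hz'⟩
    · have hmove : ctMove M D b (⟨i, s⟩, ⟨j, q⟩, T) y := by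
        by_contra h
        exact hy (if_neg h)
      cases b with
      | b₁ =>
        obtain ⟨rfl, rfl, hi, rfl⟩ := hmove
        rcases hx with hx | hx
        · exact Or.inr ⟨Finset.mem_insert_self _ _, by
            change (insert i T).card = _
            rw [Finset.card_insert_of_notMem hi, hx.2.1], (hR i j).init_mem⟩
        · exact absurd hx.1 hi
      | b₂ =>
        obtain ⟨rfl, rfl, hi, i', hi', rfl⟩ := hmove
        rcases hx with hx | hx
        · exact Or.inl ⟨hi'.1.2, hx.2.1, rfl, rfl⟩
        · exact absurd hx.1 hi
      | b₃ =>
        obtain ⟨hq, hi, i', j', hi', hj', rfl⟩ := hmove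
        rcases hx with hx | hx
        · exact absurd hi hx.1
        · exact Or.inl ⟨hi'.1, hx.2.1.trans hj'.symm, rfl, rfl⟩
  transient := by
    intro p hp f hf
    have hV : (centralised M D).IsValue (ctLive M D R) p 0 f := by
      rw [isValue_iff]
      have : killedReward (ctLive M D R) p (0 : CtState S Q → A ⊕ CtMove → ℝ) = 0 := by
        ext s
        simp [killedReward]
      rw [this, zero_add, hf]
    have hρ : RestrictsTo M (0 : CtState S Q → A ⊕ CtMove → ℝ) fun i j => (0 : S i × Q j → A → ℝ) :=
      ⟨fun _ _ _ _ _ _ _ => rfl, fun _ _ => rfl⟩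
    have hb := fun t (ht : t ≤ n) => value_isBracketed hM hR hp hρ hV (m := 0) (m' := 0)
      (fun i j p' _ => by simp [policyValue_zero]) ht
    have hz : ∀ {T : Finset (Fin n)} {t : ℕ} {z : ℝ}, IsBracketed 0 0 T t z → z = 0 := by
      rintro T t z ⟨x, -, h1, h2⟩
      simp at h1 h2
      exact le_antisymm h2 h1
    choose c hc using hM
    ext ⟨⟨i, s⟩, ⟨j, q⟩, T⟩
    by_cases hx : ((⟨i, s⟩, ⟨j, q⟩, T) : CtState S Q) ∈ ctLive M D R
    · rcases hx.1 with ⟨hi, hT, hs, hq⟩ | ⟨hi, hT, hsq⟩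
      · dsimp only at hi hT hs hq
        rw [hs, hq]
        exact hz ((hb j j.2.le).2 T i j hT hi rfl)
      · dsimp only at hi hT hsq
        obtain ⟨U, hUb, hU⟩ := (hb (j + 1) j.2).1 T hT
        rw [value_working (fun i s => ⟨c i s, hc i s⟩) hc hR hp hρ hV hi hT
          (fun s q hsq hq => hU i j s q hi rfl hsq hq) hsq, hz hUb, policyValue_zero]
        simp
    · exact hV.eq_zero _ hx

end Central
end MORAP

namespace MORAP
open MDP

/-! ### Permutation matrices and schedulers following an assignment -/

theorem sum_permMatrix_mul {n : ℕ} (σ : Equiv.Perm (Fin n)) (e : Fin n → Fin n → ℝ) :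
    ∑ i, ∑ j, σ.permMatrix ℝ i j * e i j = ∑ i, e i (σ i) := by
  refine Finset.sum_congr rfl fun i _ => ?_
  simp [Equiv.Perm.permMatrix, PEquiv.toMatrix_apply, eq_comm]

/-- By Birkhoff's theorem, a linear function on the doubly stochastic matrices is bounded by its
values at the permutation matrices. -/
theorem sum_mul_le_of_mem_doublyStochastic {n : ℕ} {x : Matrix (Fin n) (Fin n) ℝ}
    (hx : x ∈ doublyStochastic ℝ (Fin n)) {e : Fin n → Fin n → ℝ} {K : ℝ}
    (hK : ∀ σ : Equiv.Perm (Fin n), ∑ i, e i (σ i) ≤ K) : ∑ i, ∑ j, x i j * e i j ≤ K := by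
  obtain ⟨w, hw0, hw1, rfl⟩ := exists_eq_sum_perm_of_mem_doublyStochastic hx
  calc _ = ∑ σ, w σ * ∑ i, ∑ j, σ.permMatrix ℝ i j * e i j := by
        simp only [Matrix.sum_apply, Matrix.smul_apply, smul_eq_mul, Finset.sum_mul,
          Finset.mul_sum, mul_assoc]
        exact (Finset.sum_congr rfl fun i _ => Finset.sum_comm).trans Finset.sum_comm
    _ ≤ ∑ σ, w σ * K := Finset.sum_le_sum fun σ _ =>
        mul_le_mul_of_nonneg_left ((sum_permMatrix_mul σ e).trans_le (hK σ)) (hw0 σ)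
    _ = K := by rw [← Finset.sum_mul, hw1, one_mul]

section

variable {n : ℕ}

/-- The agents assigned to the first `t` tasks. -/
def assigned (f : Equiv.Perm (Fin n)) (t : ℕ) : Finset (Fin n) :=
  (Finset.univ.filter fun j : Fin n => (j : ℕ) < t).map f.toEmbedding

theorem mem_assigned {f : Equiv.Perm (Fin n)} {t : ℕ} {i : Fin n} :
    i ∈ assigned f t ↔ (f.symm i : ℕ) < t := by
  simp [assigned, Finset.mem_map_equiv]

theorem card_assigned (f : Equiv.Perm (Fin n)) {t : ℕ} (ht : t ≤ n) : (assigned f t).card = t := by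
  rw [assigned, Finset.card_map, Fin.card_filter_val_lt, min_eq_right ht]

theorem assigned_succ (f : Equiv.Perm (Fin n)) (j : Fin n) :
    assigned f (j + 1) = insert (f j) (assigned f j) := by
  ext i
  rw [Finset.mem_insert, mem_assigned, mem_assigned, Nat.lt_succ_iff, Nat.le_iff_lt_or_eq, or_comm,
    Fin.val_inj, Equiv.symm_apply_eq]

/-- The sum of `g` over the tasks that are left when the first `t` ones are completed. -/
noncomputable def tailSum (g : Fin n → ℝ) (t : ℕ) : ℝ := ∑ j : Fin n, if t ≤ (j : ℕ) then g j else 0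

theorem tailSum_self (g : Fin n → ℝ) : tailSum g n = 0 :=
  Finset.sum_eq_zero fun j _ => if_neg (not_le.2 j.2)

theorem tailSum_zero (g : Fin n → ℝ) : tailSum g 0 = ∑ j, g j := by
  simp [tailSum]

theorem tailSum_eq_add (g : Fin n → ℝ) (j : Fin n) :
    tailSum g j = g j + tailSum g (j + 1) := by
  have h : g j = ∑ j', if j' = j then g j' else 0 := by simp
  rw [h, tailSum, tailSum, ← Finset.sum_add_distrib]
  refine Finset.sum_congr rfl fun j' _ => ?_
  rcases lt_trichotomy (j' : ℕ) j with h | h | h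
  · rw [if_neg (by omega), if_neg (fun e => by subst e; omega), if_neg (by omega), add_zero]
  · obtain rfl := Fin.ext h
    simp
  · rw [if_pos h.le, if_neg (fun e => by subst e; omega), if_pos (by omega), zero_add]

end

theorem restrictsTo_ctReward {n : ℕ} {AP A : Type*} {S Q : Fin n → Type*}
    [∀ i, Fintype (S i)] {M : ∀ i, MDP (S i) A AP} (ρ' : ∀ i j, S i × Q j → A → ℝ) :
    RestrictsTo M (ctReward M ρ') ρ' :=
  ⟨fun i j s q T a ha => by simp [ctReward, ha], fun x b => by simp [ctReward]⟩

theorem restrictsTo_weighted {n : ℕ} {AP A : Type*} {S Q : Fin n → Type*}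
    [∀ i, Fintype (S i)] {M : ∀ i, MDP (S i) A AP} {D : ∀ j, DFA (Set AP) (Q j)}
    (ρ : ∀ i, S i → A → ℝ) (w : Fin n ⊕ Fin n → ℝ) :
    RestrictsTo M (fun x a => ∑ k, w k * ctReward M (objective D ρ k) x a)
      (weighted D ρ w) := by
  refine ⟨fun i j s q T a ha => ?_, fun x b => ?_⟩
  · simp only [weighted, (restrictsTo_ctReward (M := M) _).1 i j s q T a ha]
  · simp only [(restrictsTo_ctReward (M := M) _).2, mul_zero, Finset.sum_const_zero]

section

variable {n : ℕ} [NeZero n] {AP A : Type*} [Fintype A] {S Q : Fin n → Type*}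
  [∀ i, Fintype (S i)] [∀ j, Fintype (Q j)]
  {M : ∀ i, MDP (S i) A AP} {D : ∀ j, DFA (Set AP) (Q j)}
  {R : ∀ i j, Set (S i × Q j)}

/-- The value at the initial state of a policy for agent `i` on task `j`. -/
noncomputable abbrev atValue (M : ∀ i, MDP (S i) A AP) (D : ∀ j, DFA (Set AP) (Q j))
    (R : ∀ i j, Set (S i × Q j)) (i j : Fin n) (p ρ : S i × Q j → A → ℝ) : ℝ :=
  (agentTask (M i) (D j)).policyValue (atLive M D R i j) p ρ ((M i).init, (D j).start)

/-- The value at the initial state of a policy of the centralised MDP. -/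
noncomputable abbrev ctValue (M : ∀ i, MDP (S i) A AP) (D : ∀ j, DFA (Set AP) (Q j))
    (R : ∀ i j, Set (S i × Q j)) (p ρ : CtState S Q → A ⊕ CtMove → ℝ) : ℝ :=
  (centralised M D).policyValue (ctLive M D R) p ρ (centralised M D).init

theorem exists_mem_doublyStochastic (hM : ∀ i s, ((M i).enabled s).Nonempty)
    (hR : ∀ i j, (agentTask (M i) (D j)).IsProper (fun W => none ∈ W) (R i j))
    {p : CtState S Q → A ⊕ CtMove → ℝ} (hp : p ∈ (centralised M D).policies)
    {ρct : CtState S Q → A ⊕ CtMove → ℝ} {ρat : ∀ i j, S i × Q j → A → ℝ}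
    (hρ : RestrictsTo M ρct ρat) {m m' : Fin n → Fin n → ℝ}
    (hm : ∀ i j, ∀ p' ∈ (agentTask (M i) (D j)).policies,
      atValue M D R i j p' (ρat i j) ∈ Set.Icc (m i j) (m' i j)) :
    ∃ x ∈ doublyStochastic ℝ (Fin n), ∑ i, ∑ j, x i j * m i j ≤ ctValue M D R p ρct ∧
      ctValue M D R p ρct ≤ ∑ i, ∑ j, x i j * m' i j := by
  have hV := (isProper_centralised hM hR).isValue_policyValue hp ρct
  obtain ⟨x, hx, h1, h2⟩ := (value_isBracketed hM hR hp hρ hV hm n.zero_le).2 ∅ 0 0 (by simp)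
    (by simp) (by simp)
  exact ⟨x, mem_doublyStochastic_iff_sum.2 ⟨hx.nonneg, by simpa using hx.sum_row,
    by simpa using hx.sum_col⟩, h1, h2⟩

theorem ctValue_le (hM : ∀ i s, ((M i).enabled s).Nonempty)
    (hR : ∀ i j, (agentTask (M i) (D j)).IsProper (fun W => none ∈ W) (R i j))
    {p : CtState S Q → A ⊕ CtMove → ℝ} (hp : p ∈ (centralised M D).policies)
    {ρct : CtState S Q → A ⊕ CtMove → ℝ} {ρat : ∀ i j, S i × Q j → A → ℝ}
    (hρ : RestrictsTo M ρct ρat) {e : Fin n → Fin n → ℝ}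
    (he : ∀ i j, ∀ p' ∈ (agentTask (M i) (D j)).policies,
      atValue M D R i j p' (ρat i j) ≤ e i j) {K : ℝ}
    (hK : ∀ σ : Equiv.Perm (Fin n), ∑ i, e i (σ i) ≤ K) : ctValue M D R p ρct ≤ K := by
  have hlow : ∀ i j, ∃ m, ∀ p' ∈ (agentTask (M i) (D j)).policies,
      m ≤ atValue M D R i j p' (ρat i j) := by
    intro i j
    by_cases hne : (agentTask (M i) (D j)).policies.Nonempty
    · obtain ⟨m, m', hm, -⟩ := (hR i j).exists_expReward_eq hne (ρat i j)
      exact ⟨m, fun p' hp' => (hm p' hp').1⟩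
    · exact ⟨0, fun p' hp' => absurd ⟨p', hp'⟩ hne⟩
  choose m hm using hlow
  obtain ⟨x, hx, -, h2⟩ := exists_mem_doublyStochastic hM hR hp hρ (m := m) (m' := e)
    fun i j p' hp' => ⟨hm i j p' hp', he i j p' hp'⟩
  exact h2.trans (sum_mul_le_of_mem_doublyStochastic hx hK)

open Classical in
/-- The policy that lets agent `f j` take task `j` and act according to `w (f j) j`. If the
current agent is not `f j` and cannot forward the task, it takes the task itself; the policy
reaches no such state. -/
noncomputable def assignmentPolicy (M : ∀ i, MDP (S i) A AP) (D : ∀ j, DFA (Set AP) (Q j))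
    (f : Equiv.Perm (Fin n)) (w : ∀ i j, S i × Q j → A → ℝ) :
    CtState S Q → A ⊕ CtMove → ℝ := fun x =>
  if x.1.1 ∈ x.2.2 then
    if Ended (D x.2.1.1) x.2.1.2 then Pi.single (.inr .b₃) 1
    else Sum.elim (w x.1.1 x.2.1.1 (x.1.2, x.2.1.2)) 0
  else if f x.2.1.1 ≠ x.1.1 ∧ .inr .b₂ ∈ (centralised M D).enabled x then Pi.single (.inr .b₂) 1
  else Pi.single (.inr .b₁) 1

theorem assignmentPolicy_mem (hM : ∀ i s, ((M i).enabled s).Nonempty) (f : Equiv.Perm (Fin n))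
    {w : ∀ i j, S i × Q j → A → ℝ} (hw : ∀ i j, w i j ∈ (agentTask (M i) (D j)).policies) :
    assignmentPolicy M D f w ∈ (centralised M D).policies := by
  classical
  refine ⟨fun x => ?_, ?_⟩
  · unfold assignmentPolicy
    split_ifs
    · exact single_mem_stdSimplex ℝ _
    · have := (hw x.1.1 x.2.1.1).1 (x.1.2, x.2.1.2)
      refine ⟨fun a => ?_, ?_⟩
      · cases a with
        | inl a => exact this.1 a
        | inr b => exact le_rfl
      · rw [Fintype.sum_sum_type]
        simpa using this.2
    · exact single_mem_stdSimplex ℝ _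
    · exact single_mem_stdSimplex ℝ _
  · rintro ⟨⟨i, s⟩, ⟨j, q⟩, T⟩ hne a ha
    by_cases hi : i ∈ T
    · by_cases hq : Ended (D j) q
      · simp only [assignmentPolicy, if_pos hi, if_pos hq]
        refine Pi.single_eq_of_ne ?_ _
        rintro rfl
        obtain ⟨a' | b, hb⟩ := hne
        · exact (inl_mem_enabled_centralised.1 hb).1.2 hq
        · obtain ⟨y, hy⟩ := inr_mem_enabled_centralised.1 hb
          cases b with
          | b₁ => exact hy.2.2.1 hi
          | b₂ => exact hy.2.2.1 hi
          | b₃ => exact ha hb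
      · simp only [assignmentPolicy, if_pos hi, if_neg hq]
        cases a with
        | inl a =>
          refine (hw i j).2 (s, q) (by rw [enabled_agentTask]; exact hM i s) a fun h => ?_
          rw [enabled_agentTask] at h
          exact ha (inl_mem_enabled_centralised.2 ⟨⟨hi, hq⟩, h⟩)
        | inr b => rfl
    · simp only [assignmentPolicy, if_neg hi]
      split_ifs with h
      · refine Pi.single_eq_of_ne ?_ _
        rintro rfl
        exact ha h.2
      · refine Pi.single_eq_of_ne ?_ _
        rintro rfl
        obtain ⟨a' | b, hb⟩ := hne
        · exact hi (inl_mem_enabled_centralised.1 hb).1.1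
        · obtain ⟨y, hy⟩ := inr_mem_enabled_centralised.1 hb
          cases b with
          | b₁ => exact ha hb
          | b₂ => exact ha (inr_mem_enabled_centralised.2 ⟨_, hy.1, hy.2.1, hi, rfl⟩)
          | b₃ => exact hi hy.2.1

/-- Backward induction as in `value_isBracketed`, along the states visited by the assignment
policy. -/
theorem value_assignmentPolicy (hM : ∀ i s, ((M i).enabled s).Nonempty)
    (hR : ∀ i j, (agentTask (M i) (D j)).IsProper (fun W => none ∈ W) (R i j))
    (f : Equiv.Perm (Fin n))
    {w : ∀ i j, S i × Q j → A → ℝ} (hw : ∀ i j, w i j ∈ (agentTask (M i) (D j)).policies)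
    {ρct : CtState S Q → A ⊕ CtMove → ℝ} {ρat : ∀ i j, S i × Q j → A → ℝ}
    (hρ : RestrictsTo M ρct ρat) {V : CtState S Q → ℝ}
    (hV : (centralised M D).IsValue (ctLive M D R) (assignmentPolicy M D f w) ρct V)
    {g : Fin n → ℝ} (hg : ∀ j, g j = atValue M D R (f j) j (w (f j) j) (ρat (f j) j))
    {t : ℕ} (ht : t ≤ n) :
    (∀ (i j : Fin n) (s : S i) (q : Q j), i ∈ assigned f t → (j : ℕ) + 1 = t → (s, q) ∈ R i j →
      Ended (D j) q → V (⟨i, s⟩, ⟨j, q⟩, assigned f t) =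
        tailSum g t) ∧
    ∀ i j : Fin n, (j : ℕ) = t → i ∉ assigned f t → i ≤ f j →
      V (⟨i, (M i).init⟩, ⟨j, (D j).start⟩, assigned f t) =
        tailSum g t := by
  classical
  have hp := assignmentPolicy_mem hM f hw
  choose c hc using hM
  induction ht using Nat.decreasingInduction with
  | self =>
    refine ⟨fun i j s q _ hj _ hq => ?_, fun i j hj => absurd j.2 (by omega)⟩
    rw [value_eq_zero hV hj hq, tailSum_self]
  | of_succ t ht ih =>
    have hchoice : ∀ i j : Fin n, (j : ℕ) = t → i ∉ assigned f t → i ≤ f j →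
        V (⟨i, (M i).init⟩, ⟨j, (D j).start⟩, assigned f t) =
        tailSum g t := by
      intro i j hj hi hij
      subst hj
      have hfj : f j ∉ assigned f j := by simp [mem_assigned]
      have hwork : V (⟨f j, (M (f j)).init⟩, ⟨j, (D j).start⟩, insert (f j) (assigned f j)) =
          tailSum g j := by
        have hmem : f j ∈ assigned f (j + 1) := by simp [mem_assigned]
        have hloc : ∀ x ∈ atLive M D R (f j) j,
            localPolicy D c (assignmentPolicy M D f w) (f j) j (assigned f (j + 1)) x =
              w (f j) j x := by
          intro x hx
          have hne : ¬ Ended (D j) x.2 := mem_liveSet_agentTask.1 hx.2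
          simp [localPolicy, assignmentPolicy, hmem, hne]
        rw [← assigned_succ, tailSum_eq_add, hg, value_working (fun i s => ⟨c i s, hc i s⟩) hc hR
          hp hρ hV hmem (card_assigned f ht)
          (fun s q hsq hq => ih.1 (f j) j s q hmem rfl hsq hq) (hR (f j) j).init_mem,
          policyValue_congr _ hloc]
      induction i using WellFoundedGT.induction with
      | ind i IH =>
        by_cases hlive : (j : ℕ) + 1 = n ∧ Ended (D j) (D j).start
        · rw [← hwork, value_eq_zero hV hlive.1 hlive.2, value_eq_zero hV hlive.1 hlive.2]
        obtain ⟨z, hz⟩ : ∃ z, ∀ i', IsLeast {i'' | i < i'' ∧ i'' ∉ assigned f j} i' →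
            z = V (⟨i', (M i').init⟩, ⟨j, (D j).start⟩, assigned f j) := by
          by_cases h : ∃ i', IsLeast {i'' | i < i'' ∧ i'' ∉ assigned f j} i'
          · obtain ⟨i', hi'⟩ := h
            exact ⟨V (⟨i', (M i').init⟩, ⟨j, (D j).start⟩, assigned f j),
              fun i'' hi'' => by rw [hi'.unique hi'']⟩
          · exact ⟨0, fun i' hi' => absurd ⟨i', hi'⟩ h⟩
        rw [(value_choice hp hρ hV hi (card_assigned f j.2.le) hlive hz).2]
        rcases hij.eq_or_lt with rfl | hlt
        · rw [hwork]
          simp [assignmentPolicy, hi]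
        · obtain ⟨i', hi'⟩ := exists_isLeast_gt_notMem hlt hfj
          have hb : .inr .b₂ ∈ (centralised M D).enabled
              (⟨i, (M i).init⟩, ⟨j, (D j).start⟩, assigned f j) :=
            inr_mem_enabled_centralised.2 ⟨_, rfl, rfl, hi, i', hi', rfl⟩
          rw [hz i' hi', IH i' hi'.1.1 (hi'.2 ⟨hlt, hfj⟩) hi'.1.2]
          simp [assignmentPolicy, hi, hb, hlt.ne']
    refine ⟨fun i j s q hi hj hsq hq => ?_, hchoice⟩
    have hcard := card_assigned f ht.le
    obtain ⟨i', hi'⟩ := exists_isLeast_notMem (T := assigned f t) (by omega)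
    rw [value_next_task hp hρ hV (j' := ⟨t, ht⟩) hi (by omega) hsq hq hi' (by simp [hj])]
    exact hchoice i' ⟨t, ht⟩ rfl hi'.1 (hi'.2 (by simp [mem_assigned]))

theorem ctValue_assignmentPolicy (hM : ∀ i s, ((M i).enabled s).Nonempty)
    (hR : ∀ i j, (agentTask (M i) (D j)).IsProper (fun W => none ∈ W) (R i j))
    (f : Equiv.Perm (Fin n))
    {w : ∀ i j, S i × Q j → A → ℝ} (hw : ∀ i j, w i j ∈ (agentTask (M i) (D j)).policies)
    {ρct : CtState S Q → A ⊕ CtMove → ℝ} {ρat : ∀ i j, S i × Q j → A → ℝ}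
    (hρ : RestrictsTo M ρct ρat) :
    ctValue M D R (assignmentPolicy M D f w) ρct =
      ∑ j, atValue M D R (f j) j (w (f j) j) (ρat (f j) j) := by
  have hV := (isProper_centralised hM hR).isValue_policyValue (assignmentPolicy_mem hM f hw) ρct
  have h0 : assigned f 0 = ∅ := by
    ext i
    simp [mem_assigned]
  have h := (value_assignmentPolicy hM hR f hw hρ hV (fun _ => rfl) n.zero_le).2 0 0 (by simp)
    (by simp [h0]) (Fin.zero_le _)
  rw [h0] at h
  exact h.trans (tailSum_zero _)

end
end MORAP

namespace MORAP
open MDP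
/-! ### Expected rewards and the decentralised algorithm -/

section
variable {n : ℕ} {AP A : Type*} [Fintype A] {S Q : Fin n → Type*}
  [∀ i, Fintype (S i)] [∀ j, Fintype (Q j)]
  {M : ∀ i, MDP (S i) A AP} {D : ∀ j, DFA (Set AP) (Q j)}
  {R : ∀ i j, Set (S i × Q j)}

theorem agentTaskReward_eq
    (hR : ∀ i j, (agentTask (M i) (D j)).IsProper (fun W => none ∈ W) (R i j)) {i j : Fin n}
    (μ : (agentTask (M i) (D j)).Scheduler) (ρ : S i × Q j → A → ℝ) :
    agentTaskReward (M i) (D j) ρ μ = (atValue M D R i j μ.weight ρ : EReal) :=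
  (hR i j).expReward_eq_policyValue μ ρ

theorem isOptimal_iff
    (hR : ∀ i j, (agentTask (M i) (D j)).IsProper (fun W => none ∈ W) (R i j)) {i j : Fin n}
    {μ : (agentTask (M i) (D j)).Scheduler} {ρ : S i × Q j → A → ℝ} :
    (agentTask (M i) (D j)).IsOptimal ρ (fun W => none ∈ W) μ ↔
      ∀ p ∈ (agentTask (M i) (D j)).policies,
        atValue M D R i j p ρ ≤ atValue M D R i j μ.weight ρ := by
  refine ⟨fun h p hp => ?_, fun h μ' => ?_⟩
  · obtain ⟨μ', rfl⟩ := exists_weight_eq hp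
    have := h μ'
    rw [(hR i j).expReward_eq_policyValue, (hR i j).expReward_eq_policyValue] at this
    exact EReal.coe_le_coe_iff.1 this
  · rw [(hR i j).expReward_eq_policyValue, (hR i j).expReward_eq_policyValue]
    exact EReal.coe_le_coe_iff.2 (h _ μ'.weight_mem)

theorem policies_nonempty (hM : ∀ i s, ((M i).enabled s).Nonempty) (i j : Fin n) :
    (agentTask (M i) (D j)).policies.Nonempty := by
  classical
  choose c hc using hM
  refine ⟨fun x => Pi.single (c i x.1) 1, fun x => single_mem_stdSimplex ℝ _, fun x _ a ha => ?_⟩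
  rw [enabled_agentTask] at ha
  exact Pi.single_eq_of_ne (fun e : a = c i x.1 => ha (e ▸ hc i x.1)) 1

theorem exists_isOutput (hM : ∀ i s, ((M i).enabled s).Nonempty)
    (hR : ∀ i j, (agentTask (M i) (D j)).IsProper (fun W => none ∈ W) (R i j))
    (ρ : ∀ i, S i → A → ℝ) (w : Fin n ⊕ Fin n → ℝ) : ∃ r, IsOutput M D ρ w r := by
  choose μ hμ using fun i j => (hR i j).exists_isOptimal (policies_nonempty hM i j)
    (weighted D ρ w i j)
  obtain ⟨f, hf⟩ := Finite.exists_max fun f : Equiv.Perm (Fin n) =>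
    ∑ j, atValue M D R (f j) j (μ (f j) j).weight (weighted D ρ w (f j) j)
  set v : Fin n ⊕ Fin n → Fin n → Fin n → ℝ := fun k i j =>
    atValue M D R i j (μ i j).weight (objective D ρ k i j) with hv
  refine ⟨Sum.elim (fun i => v (.inl i) i (f.symm i)) fun j => v (.inr j) (f j) j, μ, _, f, hμ,
    fun i j => agentTaskReward_eq hR _ _, hf, fun j => agentTaskReward_eq hR _ _, fun j => ?_⟩
  rw [agentTaskReward_eq hR, Sum.elim_inl, Equiv.symm_apply_apply]

variable [NeZero n]

theorem centralReward_eq (hM : ∀ i s, ((M i).enabled s).Nonempty)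
    (hR : ∀ i j, (agentTask (M i) (D j)).IsProper (fun W => none ∈ W) (R i j))
    (μ : (centralised M D).Scheduler) (ρ : CtState S Q → A ⊕ CtMove → ℝ) :
    centralReward M D ρ μ = (ctValue M D R μ.weight ρ : EReal) :=
  (isProper_centralised hM hR).expReward_eq_policyValue μ ρ

theorem exists_decomposition (hM : ∀ i s, ((M i).enabled s).Nonempty)
    (hR : ∀ i j, (agentTask (M i) (D j)).IsProper (fun W => none ∈ W) (R i j))
    {ρct : CtState S Q → A ⊕ CtMove → ℝ} {ρat : ∀ i j, S i × Q j → A → ℝ}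
    (hρ : RestrictsTo M ρct ρat) (μ : (centralised M D).Scheduler) :
    ∃ x ∈ doublyStochastic ℝ (Fin n),
      ∃ (μat : ∀ i j, (agentTask (M i) (D j)).Scheduler) (e : Fin n → Fin n → ℝ),
        (∀ i j, agentTaskReward (M i) (D j) (ρat i j) (μat i j) = (e i j : EReal)) ∧
        centralReward M D ρct μ = ((∑ i, ∑ j, x i j * e i j : ℝ) : EReal) := by
  choose m m' hm hval using fun i j =>
    (hR i j).exists_expReward_eq (policies_nonempty hM i j) (ρat i j)
  obtain ⟨x, hx, h1, h2⟩ := exists_mem_doublyStochastic hM hR μ.weight_mem hρ hm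
  -- The same convex combination of the end points is used in all intervals.
  obtain ⟨a, b, ha, hb, hab, hz⟩ := (Convex.mem_Icc (h1.trans h2)).1 ⟨h1, h2⟩
  have hmem : ∀ i j, a * m i j + b * m' i j ∈ Set.Icc (m i j) (m' i j) := fun i j => by
    obtain ⟨p, hp⟩ := policies_nonempty (D := D) hM i j
    have hle := (hm i j p hp).1.trans (hm i j p hp).2
    exact (Convex.mem_Icc hle).2 ⟨a, b, ha, hb, hab, rfl⟩
  choose μat hμat using fun i j => hval i j _ (hmem i j)
  refine ⟨x, hx, μat, fun i j => a * m i j + b * m' i j, hμat, ?_⟩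
  rw [centralReward_eq hM hR, ← hz]
  congr 1
  simp only [Finset.mul_sum, ← Finset.sum_add_distrib]
  exact Finset.sum_congr rfl fun i _ => Finset.sum_congr rfl fun j _ => by ring

/-- The upper bound is Birkhoff's theorem; it is attained by the policy following the best
assignment. -/
theorem exists_perm_isGreatest (hM : ∀ i s, ((M i).enabled s).Nonempty)
    (hR : ∀ i j, (agentTask (M i) (D j)).IsProper (fun W => none ∈ W) (R i j))
    {ρct : CtState S Q → A ⊕ CtMove → ℝ} {ρat : ∀ i j, S i × Q j → A → ℝ}
    (hρ : RestrictsTo M ρct ρat) (μopt : ∀ i j, (agentTask (M i) (D j)).Scheduler)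
    (hopt : ∀ i j, (agentTask (M i) (D j)).IsOptimal (ρat i j) (fun W => none ∈ W) (μopt i j)) :
    ∃ (σ : Equiv.Perm (Fin n)) (e : Fin n → Fin n → ℝ),
      (∀ i j, agentTaskReward (M i) (D j) (ρat i j) (μopt i j) = (e i j : EReal)) ∧
      IsGreatest (Set.range fun μ => centralReward M D ρct μ)
        ((∑ i, ∑ j, σ.permMatrix ℝ i j * e i j : ℝ) : EReal) := by
  set e : Fin n → Fin n → ℝ := fun i j => atValue M D R i j (μopt i j).weight (ρat i j) with he
  obtain ⟨σ, hσ⟩ := Finite.exists_max fun σ : Equiv.Perm (Fin n) => ∑ i, e i (σ i)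
  refine ⟨σ, e, fun i j => agentTaskReward_eq hR _ _, ?_, ?_⟩
  · have hw : ∀ i j, (μopt i j).weight ∈ (agentTask (M i) (D j)).policies :=
      fun i j => (μopt i j).weight_mem
    obtain ⟨μ, hμ⟩ := exists_weight_eq (assignmentPolicy_mem hM σ.symm hw)
    refine ⟨μ, ?_⟩
    dsimp only
    rw [centralReward_eq hM hR, hμ, ctValue_assignmentPolicy hM hR σ.symm hw hρ,
      sum_permMatrix_mul]
    congr 1
    rw [← Equiv.sum_comp σ.symm fun i => e i (σ i)]
    simp only [Equiv.apply_symm_apply, he]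
  · rintro _ ⟨μ, rfl⟩
    dsimp only
    rw [centralReward_eq hM hR, sum_permMatrix_mul]
    exact EReal.coe_le_coe_iff.2 (ctValue_le hM hR μ.weight_mem hρ
      (fun i j => (isOptimal_iff hR).1 (hopt i j)) hσ)

theorem IsOutput.supportsAt (hM : ∀ i s, ((M i).enabled s).Nonempty)
    (hR : ∀ i j, (agentTask (M i) (D j)).IsProper (fun W => none ∈ W) (R i j))
    {ρ : ∀ i, S i → A → ℝ} {w r : Fin n ⊕ Fin n → ℝ} (hw : ∀ k, 0 ≤ w k)
    (hr : IsOutput M D ρ w r) :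
    r ∈ achievable M D ρ ∧ SupportsAt (feasible M D ρ) w r := by
  obtain ⟨μ, c, f, hopt, hc, hf, hinr, hinl⟩ := hr
  have hμ : ∀ i j, (μ i j).weight ∈ (agentTask (M i) (D j)).policies :=
    fun i j => (μ i j).weight_mem
  obtain ⟨μct, hμct⟩ := exists_weight_eq (assignmentPolicy_mem hM f hμ)
  simp_rw [agentTaskReward_eq hR, EReal.coe_eq_coe_iff] at hc hinr hinl
  have hval : ∀ k, ctValue M D R μct.weight (ctReward M (objective D ρ k)) = r k := by
    intro k
    rw [hμct, ctValue_assignmentPolicy hM hR f hμ (restrictsTo_ctReward _)]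
    have h0 : ∀ i j, objective D ρ k i j = 0 →
        atValue M D R i j (μ i j).weight (objective D ρ k i j) = 0 := fun i j h => by
      rw [h, atValue, policyValue_zero, Pi.zero_apply]
    rcases k with i | j₀
    -- Only the agent-task pair to which the objective belongs contributes.
    · obtain ⟨j₀, rfl⟩ := f.surjective i
      rw [← hinl j₀]
      refine Finset.sum_eq_single j₀ (fun j _ hj => h0 _ _ ?_) (by simp)
      ext x a
      exact if_neg fun e => hj (f.injective e)
    · rw [← hinr j₀]
      refine Finset.sum_eq_single j₀ (fun j _ hj => h0 _ _ ?_) (by simp)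
      ext x a
      exact if_neg hj
  have hach : r ∈ achievable M D ρ :=
    ⟨μct, fun k => by rw [centralReward_eq hM hR, hval k]⟩
  have hlin : ∀ p : CtState S Q → A ⊕ CtMove → ℝ,
      ctValue M D R p (fun x a => ∑ k, w k * ctReward M (objective D ρ k) x a) =
        ∑ k, w k * ctValue M D R p (ctReward M (objective D ρ k)) := fun p => by
    rw [ctValue, policyValue_sum, Finset.sum_apply]
    rfl
  refine ⟨hach, ⟨r, hach, le_rfl⟩, ?_⟩
  rintro x ⟨u, ⟨μ', hμ'⟩, hxu⟩
  simp_rw [centralReward_eq hM hR, EReal.coe_eq_coe_iff] at hμ'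
  calc ∑ k, w k * x k ≤ ∑ k, w k * u k :=
        Finset.sum_le_sum fun k _ => mul_le_mul_of_nonneg_left (hxu k) (hw k)
    _ = ctValue M D R μ'.weight (fun x a => ∑ k, w k * ctReward M (objective D ρ k) x a) := by
        simp_rw [hlin, hμ']
    _ ≤ ∑ j, c (f j) j := by
        refine ctValue_le hM hR μ'.weight_mem (restrictsTo_weighted ρ w) (e := c)
          (fun i j p hp => ?_) fun σ => ?_
        · rw [← hc i j]
          exact (isOptimal_iff hR).1 (hopt i j) p hp
        · refine le_trans (le_of_eq ?_) (hf σ.symm)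
          rw [← Equiv.sum_comp σ.symm fun i => c i (σ i)]
          simp
    _ = ctValue M D R μct.weight (fun x a => ∑ k, w k * ctReward M (objective D ρ k) x a) := by
        rw [hμct, ctValue_assignmentPolicy hM hR f hμ (restrictsTo_weighted ρ w)]
        simp_rw [hc]
    _ = ∑ k, w k * r k := by simp_rw [hlin, hval]

end
end MORAP

theorem mainTheorem4 {n : ℕ} [NeZero n] {AP A : Type*} [Fintype A]
    {S Q : Fin n → Type*} [∀ i, Fintype (S i)] [∀ j, Fintype (Q j)]
    (M : ∀ i, MDP (S i) A AP) (D : ∀ j, DFA (Set AP) (Q j)) (ρ : ∀ i, S i → A → ℝ)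
    (hM : ∀ i s, ((M i).enabled s).Nonempty)
    (hD : ∀ j, ∀ q ∈ (D j).accept, ∀ W, (D j).step q W = q)
    (hρ : ∀ i j, (agentTask (M i) (D j)).RewardFinite (fun x a => ρ i x.1 a)
      (fun W => none ∈ W)) :
    -- decomposition of the centralised rewards
    (∀ (ρct : CtState S Q → A ⊕ CtMove → ℝ) (ρat : ∀ i j, S i × Q j → A → ℝ),
      RestrictsTo M ρct ρat →
        (∀ μ : (centralised M D).Scheduler,
          ∃ x ∈ doublyStochastic ℝ (Fin n),
          ∃ (μat : ∀ i j, (agentTask (M i) (D j)).Scheduler) (e : Fin n → Fin n → ℝ),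
            (∀ i j, agentTaskReward (M i) (D j) (ρat i j) (μat i j) = (e i j : EReal)) ∧
            centralReward M D ρct μ = ((∑ i, ∑ j, x i j * e i j : ℝ) : EReal)) ∧
        (∃ μopt : ∀ i j, (agentTask (M i) (D j)).Scheduler,
          ∀ i j, (agentTask (M i) (D j)).IsOptimal (ρat i j) (fun W => none ∈ W) (μopt i j)) ∧
        (∀ μopt : ∀ i j, (agentTask (M i) (D j)).Scheduler,
          (∀ i j, (agentTask (M i) (D j)).IsOptimal (ρat i j) (fun W => none ∈ W) (μopt i j)) →
          ∃ (σ : Equiv.Perm (Fin n)) (e : Fin n → Fin n → ℝ),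
            (∀ i j, agentTaskReward (M i) (D j) (ρat i j) (μopt i j) = (e i j : EReal)) ∧
            IsGreatest (Set.range fun μ => centralReward M D ρct μ)
              ((∑ i, ∑ j, σ.permMatrix ℝ i j * e i j : ℝ) : EReal))) ∧
    -- correctness of the decentralised algorithm
    (∀ w ∈ stdSimplex ℝ (Fin n ⊕ Fin n),
      (∃ r, IsOutput M D ρ w r) ∧
      ∀ r, IsOutput M D ρ w r → r ∈ achievable M D ρ ∧ SupportsAt (feasible M D ρ) w r) := by
  have hen : ∀ i j x, ((agentTask (M i) (D j)).enabled x).Nonempty := fun i j x => by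
    rw [enabled_agentTask]
    exact hM i x.1
  choose R hR using fun i j => MDP.exists_isProper (hen i j) (hρ i j)
  refine ⟨fun ρct ρat hct => ⟨exists_decomposition hM hR hct, ?_,
    exists_perm_isGreatest hM hR hct⟩, fun w hw => ⟨exists_isOutput hM hR ρ w,
    fun r hr => hr.supportsAt hM hR hw.1⟩⟩
  choose μopt hopt using fun i j => (hR i j).exists_isOptimal (policies_nonempty hM i j) (ρat i j)
  exact ⟨μopt, hopt⟩
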